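/- Write $\mathbb{R}^+=[0,\infty)$. Let $K:\mathbb{R}\to\mathbb{R}$ satisfy: 1) $K>0$, $K(-x)=K(x)$, $K\in C^1(\mathbb{R})$, and $K$, $K'$ are bounded; 2) $K$ is strictly decreasing on $\mathbb{R}^+$ and $\int_0^\infty K(t)\,dt=\frac12$; 3) $\int_0^\infty xK(x)\,dx<\infty$. Let $\omega_2\in C(\mathbb{R}^+\times\mathbb{R}^+)$ with $\omega_2(t,0)=0$ be such that: $b_1)$ for each $t\ge0$ the function $u\mapsto\omega_2(t,u)$ is monotonically increasing and concave on $\mathbb{R}^+$; $b_2)$ there is a positive integrable function $\mu_2$ on $\mathbb{R}^+$ with $\mu_2(t)\to0$ as $t\to\infty$ and $\omega_2(t,u)\le\mu_2(t)u$ for all $t,u\ge 0$. Put $M=\int_0^\infty\mu_2(t)\,dt\cdot\sup_{x\in\mathbb{R}}K(x)$. Let $Q:\mathbb{R}^+\to\mathbb{R}^+$, $Q(0)=0$, satisfy: I) $Q$ is continuous and strictly increasing; II) $Q$ is convex and $Q(\xi)=(1+M)\xi$ for some $\xi>0$; III) there is a continuous, monotonically increasing, concave map $\varphi:[0,1]\to[0,1]$,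 not the identity map, with $\varphi(0)=0$, $\varphi(1)=1$ and $G(\sigma u)\ge\varphi(\sigma)G(u)$ for all $\sigma\in(0,1)$ and $u\in(0,(1+M)\xi)$, where $G$ is the inverse function of $Q$ on $\mathbb{R}^+$. Then $Q$ has exactly one positive fixed point $\eta$, and the following hold. (a) The equation $Q(F(x))=\int_0^\infty (K(x-t)-K(x+t))F(t)\,dt$, $x\ge0$, has a unique non-negative, nontrivial, nondecreasing, bounded, continuous solution $F$ on $\mathbb{R}^+$; it satisfies $F(0)=0$, $F(x)>0$ for $x>0$, $\lim_{x\to\infty}F(x)=\eta$ and $\eta-F\in L_1(\mathbb{R}^+)$. The equation $Q(\Phi(x))=\int_0^\infty (K(x-t)-K(x+t))(1+\mu_2(t))\Phi(t)\,dt$, $x\ge0$, has a unique non-negative, nontrivial, bounded, continuous solution $\Phi$ on $\mathbb{R}^+$; it satisfies $\Phi(0)=0$, $F(x)<\Phi(x)<\xi$ for $x>0$, $\lim_{x\to\infty}\Phi(x)=\eta$ and $\eta-\Phi\in L_1(\mathbb{R}^+)$. (b) The equation $$Q(B(x))=\int_0^\infty (K(x-t)-K(x+t))\big(B(t)+\omega_2(t,B(t))\big)\,dt,\qquad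 x\ge0,$$ has a non-negative, nontrivial, bounded, continuous solution $B$ on $\mathbb{R}^+$ with $F\le B\le\Phi$ on $\mathbb{R}^+$, $\lim_{x\to\infty}B(x)=\eta$ and $\eta-B\in L_1(\mathbb{R}^+)$. (c) The successive approximations $B_0=\Phi$, $Q(B_{n+1}(x))=\int_0^\infty (K(x-t)-K(x+t))\big(B_n(t)+\omega_2(t,B_n(t))\big)\,dt$ are well-defined non-negative continuous functions on $\mathbb{R}^+$ with $F\le B_{n+1}\le B_n$, and converge to $B$ uniformly at a geometric rate: there is $\sigma_0\in(0,1)$ with $\sigma_0Q(B_0)\le Q(B_1)$ on $\mathbb{R}^+$ such that for every $\varepsilon_0\in(0,1)$, with $$k=\frac{1-\varphi(\varepsilon_0\sigma_0)}{1-\varepsilon_0\sigma_0},\qquad C=\frac{\xi(1-\sigma_0)}{1-k},$$ one has $k\in(0,1)$ and $0\le B_n(x)-B(x)\le C\,k^{n+1}$ for all $n=0,1,2,\dots$ and all $x\ge0$. -/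

import Mathlib

open MeasureTheory Set Filter Topology

/-- Conditions on the kernel `K`: positive, even, continuously differentiable, bounded with bounded
derivative, (strictly) decreasing on `[0, ∞)`, total mass one half on the half-line, and finite
first moment. -/
structure KernelConditions (K : ℝ → ℝ) : Prop where
  pos : ∀ x, 0 < K x
  even : ∀ x, K (-x) = K x
  contDiff : ContDiff ℝ 1 K
  bounded : ∃ c, ∀ x, |K x| ≤ c
  deriv_bounded : ∃ c, ∀ x, |deriv K x| ≤ c
  strictAntiOn : StrictAntiOn K (Ici 0)
  integrableOn : IntegrableOn K (Ioi 0)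
  integral_eq : ∫ t in Ioi (0 : ℝ), K t = 1 / 2
  moment : IntegrableOn (fun x => x * K x) (Ioi 0)

/-- Conditions on the nonlinearity `ω` on `[0, ∞) × [0, ∞)` and its linear majorant `μ(t) u`. -/
structure OmegaConditions (ω : ℝ → ℝ → ℝ) (μ : ℝ → ℝ) : Prop where
  zero : ∀ t, 0 ≤ t → ω t 0 = 0
  cont : ContinuousOn (fun p : ℝ × ℝ => ω p.1 p.2) (Ici 0 ×ˢ Ici 0)
  mono : ∀ t, 0 ≤ t → MonotoneOn (ω t) (Ici 0)
  concave : ∀ t, 0 ≤ t → ConcaveOn ℝ (Ici 0) (ω t)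
  majorant_pos : ∀ t, 0 ≤ t → 0 < μ t
  majorant_integrable : IntegrableOn μ (Ioi 0)
  majorant_tendsto : Tendsto μ atTop (𝓝 0)
  le_majorant : ∀ t, 0 ≤ t → ∀ u, 0 ≤ u → ω t u ≤ μ t * u

/-- The number `M = ∫₀^∞ μ(t) dt · sup K`. -/
noncomputable def massConstant (K μ : ℝ → ℝ) : ℝ :=
  (∫ t in Ioi (0 : ℝ), μ t) * ⨆ x, K x

/-- The inverse function of `Q : [0, ∞) → [0, ∞)`. -/
noncomputable def halfLineInverse (Q : ℝ → ℝ) : ℝ → ℝ :=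
  Function.invFunOn Q (Ici 0)

/-- Conditions on the nonlinearity `Q` on `[0, ∞)`, with the number `ξ`, the constant `M` and the
comparison function `φ : [0, 1] → [0, 1]`. The last field excludes the degenerate choice
`φ(σ) = σ`, for which `inverse_ge` holds for every convex `Q` with `Q(0) = 0`. -/
structure QConditions (Q : ℝ → ℝ) (M ξ : ℝ) (φ : ℝ → ℝ) : Prop where
  zero : Q 0 = 0
  cont : ContinuousOn Q (Ici 0)
  strictMono : StrictMonoOn Q (Ici 0)
  convex : ConvexOn ℝ (Ici 0) Q
  xi_pos : 0 < ξ
  xi_eq : Q ξ = (1 + M) * ξ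
  phi_mapsTo : MapsTo φ (Icc 0 1) (Icc 0 1)
  phi_cont : ContinuousOn φ (Icc 0 1)
  phi_mono : MonotoneOn φ (Icc 0 1)
  phi_concave : ConcaveOn ℝ (Icc 0 1) φ
  phi_zero : φ 0 = 0
  phi_one : φ 1 = 1
  inverse_ge : ∀ σ ∈ Ioo (0 : ℝ) 1, ∀ u ∈ Ioo 0 ((1 + M) * ξ),
    φ σ * halfLineInverse Q u ≤ halfLineInverse Q (σ * u)
  phi_ne_id : ∃ σ ∈ Icc (0 : ℝ) 1, φ σ ≠ σ

/-- `v` is obtained from `u` by one step of the successive approximations with nonlinearity `N`: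
`Q(v(x)) = ∫₀^∞ (K(x - t) - K(x + t)) N(t, u(t)) dt` for all `x ≥ 0`, the integral being
absolutely convergent. -/
def IsStep (K Q : ℝ → ℝ) (N : ℝ → ℝ → ℝ) (u v : ℝ → ℝ) : Prop :=
  ∀ x, 0 ≤ x →
    IntegrableOn (fun t => (K (x - t) - K (x + t)) * N t (u t)) (Ioi 0) ∧
    Q (v x) = ∫ t in Ioi (0 : ℝ), (K (x - t) - K (x + t)) * N t (u t)

/-- `u` is a non-negative, nontrivial, bounded and continuous solution on `[0, ∞)` of
`Q(u(x)) = ∫₀^∞ (K(x - t) - K(x + t)) N(t, u(t)) dt`. -/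
structure IsNontrivialSolution (K Q : ℝ → ℝ) (N : ℝ → ℝ → ℝ) (u : ℝ → ℝ) : Prop where
  nonneg : ∀ x, 0 ≤ x → 0 ≤ u x
  nontrivial : ∃ x, 0 ≤ x ∧ u x ≠ 0
  bounded : ∃ c, ∀ x, 0 ≤ x → u x ≤ c
  cont : ContinuousOn u (Ici 0)
  eqn : IsStep K Q N u u

/-- The nonlinearity `u` of the lower auxiliary equation. -/
def lowerNonlinearity (_t u : ℝ) : ℝ := u

/-- The nonlinearity `(1 + μ(t)) u` of the upper auxiliary equation. -/
def upperNonlinearity (μ : ℝ → ℝ) (t u : ℝ) : ℝ := (1 + μ t) * u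

/-- The nonlinearity `u + ω(t, u)` of the main equation. -/
def mainNonlinearity (ω : ℝ → ℝ → ℝ) (t u : ℝ) : ℝ := u + ω t u

/-- The ratio `k = (1 - φ(ε σ)) / (1 - ε σ)` of the geometric progression. -/
noncomputable def geometricRatio (φ : ℝ → ℝ) (σ ε : ℝ) : ℝ :=
  (1 - φ (ε * σ)) / (1 - ε * σ)

/-!
# Integral equations on the half-line with a convex nonlinearity

The kernel `K(x - t) - K(x + t)` is symmetric and non-negative for `x, t ≥ 0`, and its integral
over `t > 0` is `1 - 2 ∫ₓ^∞ K`. The three nonlinearities `u`, `u + ω(t, u)` and `(1 + μ(t)) u` are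
increasing in `u` and lie between `u` and `(1 + μ(t)) u` (`SandwichedNonlinearity`), so one theory
serves all of them.

*The role of `φ`.* A concave `φ` on `[0, 1]` that fixes the end points and is not the identity
satisfies `φ(σ) > σ` inside. Iterating `Q⁻¹(σ u) ≥ φ(σ) Q⁻¹(u)` gives `Q(v) = o(v)` at the origin
(`QConditions.exists_le_mul`), and convexity then makes `Q(v) / v` strictly increasing
(`QConditions.mul_lt_mul`). Hence the positive fixed point `η` exists and is unique, and
`Q` expands distances to `η` by a factor `q > 1` away from the origin.

*Existence.* The approximations from the constant `β` with `Q(β) = (1 + K(0) ∫ μ) β` decrease to the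
largest solution (`exists_largest_solution`). It does not vanish, because `ε` times the indicator
of `[2, ∞)` is a subsolution for small `ε`.

*Asymptotics.* A nontrivial solution `u` is bounded below on `[2, ∞)`, as a lower bound on one unit
interval propagates to the next; then its lower and upper limits satisfy `Q(l) ≥ l` and `Q(L) ≤ L`,
and both are `η`. The factor `q > 1` gives `q |η - u| ≤ T |η - u| + g` near infinity, where `T` is
the integral operator and `g` is integrable thanks to the first moment of `K`. As `T` does not
increase `L¹` norms, `η - u` is integrable (`KernelConditions.integrableOn_of_le_kernelOp`).

*Uniqueness.* If `u ≤ v` solve the equation with the weight `1 + μ`, the symmetry of the kernel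
gives `∫ (1 + μ) (u Q(v) - v Q(u)) = 0`, and the integrand is positive where `u < v`
(`IsNontrivialSolution.eqOn_of_le`); here `v` is the largest solution.

*Rate of convergence.* The excess `T(μ Φ)` is `O(x)` at the origin as `K'` is bounded, whereas `T F`
is at least of order `x` there, so `T(μ Φ) ≤ C T F` and `σ₀ = 1 / (1 + C)` satisfies
`σ₀ Q(B₀) ≤ Q(B₁)`. This bound propagates to `Bₙ₊₁ ≥ φⁿ⁺¹(σ₀) Bₙ` (`phi_iterate_mul_le`), and
`1 - φⁿ(σ₀) ≤ kⁿ (1 - σ₀)` since `φ` lies above its chord from `ε₀ σ₀` to `1`.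
-/

/-! ### The kernel -/

/-- The integral of `K` over `(x, ∞)`. -/
noncomputable def kernelTail (K : ℝ → ℝ) (x : ℝ) : ℝ := ∫ t in Ioi x, K t

/-- The kernel `K(x - t) - K(x + t)` of the integral equations. -/
def diffKernel (K : ℝ → ℝ) (x t : ℝ) : ℝ := K (x - t) - K (x + t)

lemma setIntegral_Ioi_comp_add_right (f : ℝ → ℝ) (a c : ℝ) :
    ∫ t in Ioi a, f (t + c) = ∫ t in Ioi (a + c), f t := by
  have h := (measurePreserving_add_right volume c).setIntegral_preimage_emb
    (measurableEmbedding_addRight c) f (Ioi (a + c))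
  simpa using h

lemma tendsto_kernelTail (K : ℝ → ℝ) : Tendsto (kernelTail K) atTop (𝓝 0) :=
  tendsto_integral_Ioi_zero (f := K) (μ := volume) tendsto_id

namespace KernelConditions

variable {K : ℝ → ℝ}

lemma continuous (hK : KernelConditions K) : Continuous K := hK.contDiff.continuous

lemma eq_abs (hK : KernelConditions K) (x : ℝ) : K x = K |x| := by
  rcases abs_choice x with h | h <;> rw [h]
  rw [hK.even]

lemma lt_of_abs_lt (hK : KernelConditions K) {x y : ℝ} (h : |x| < |y|) : K y < K x := by
  rw [hK.eq_abs x, hK.eq_abs y]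
  exact hK.strictAntiOn (abs_nonneg x) (abs_nonneg y) h

lemma le_of_abs_le (hK : KernelConditions K) {x y : ℝ} (h : |x| ≤ |y|) : K y ≤ K x := by
  rw [hK.eq_abs x, hK.eq_abs y]
  exact hK.strictAntiOn.antitoneOn (abs_nonneg x) (abs_nonneg y) h

lemma le_zero (hK : KernelConditions K) (x : ℝ) : K x ≤ K 0 :=
  hK.le_of_abs_le (by simp)

lemma iSup_eq (hK : KernelConditions K) : ⨆ x, K x = K 0 :=
  le_antisymm (ciSup_le hK.le_zero) (le_ciSup ⟨K 0, by rintro _ ⟨x, rfl⟩; exact hK.le_zero x⟩ 0)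

lemma integrable (hK : KernelConditions K) : Integrable K := by
  have h1 : IntegrableOn K (Iic 0) := by
    have h := hK.integrableOn
    rw [← integrableOn_Ici_iff_integrableOn_Ioi] at h
    have := h.comp_neg
    simpa [hK.even] using this
  have := h1.union hK.integrableOn
  rwa [Iic_union_Ioi, integrableOn_univ] at this

lemma kernelTail_neg (hK : KernelConditions K) (x : ℝ) :
    kernelTail K (-x) = 1 - kernelTail K x := by
  have htot : ∫ t, K t = 1 := by
    have h : (fun t => K |t|) = K := by ext t; exact (hK.eq_abs t).symm
    have := integral_comp_abs (f := K)
    rw [h, hK.integral_eq] at this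
    rw [this]; norm_num
  have h1 : ∫ t in Iic x, K t = kernelTail K (-x) := by
    have := integral_comp_neg_Iic x K
    simpa [hK.even, kernelTail] using this
  have h2 := intervalIntegral.integral_Iic_add_Ioi (b := x) hK.integrable.integrableOn
    hK.integrable.integrableOn
  rw [htot, h1] at h2
  simp only [kernelTail] at *
  linarith

lemma kernelTail_eq_add (hK : KernelConditions K) (a b : ℝ) :
    kernelTail K a = (∫ t in a..b, K t) + kernelTail K b := by
  have := intervalIntegral.integral_Ioi_sub_Ioi' (a := a) (b := b) (f := K) (μ := volume)
    hK.integrable.integrableOn hK.integrable.integrableOn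
  simp only [kernelTail]
  linarith

lemma hasDerivAt_kernelTail (hK : KernelConditions K) (x : ℝ) :
    HasDerivAt (kernelTail K) (-K x) x := by
  have h : kernelTail K = fun x => kernelTail K 0 - ∫ t in (0 : ℝ)..x, K t := by
    ext x; have := hK.kernelTail_eq_add 0 x; linarith
  rw [h]
  exact (intervalIntegral.integral_hasDerivAt_right (hK.continuous.intervalIntegrable _ _)
    hK.continuous.stronglyMeasurable.stronglyMeasurableAtFilter
      hK.continuous.continuousAt).const_sub _

lemma continuous_kernelTail (hK : KernelConditions K) : Continuous (kernelTail K) :=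
  continuous_iff_continuousAt.2 fun x => (hK.hasDerivAt_kernelTail x).continuousAt

lemma kernelTail_nonneg (hK : KernelConditions K) (x : ℝ) : 0 ≤ kernelTail K x :=
  setIntegral_nonneg measurableSet_Ioi fun t _ => (hK.pos t).le

lemma kernelTail_strictAnti (hK : KernelConditions K) : StrictAnti (kernelTail K) :=
  strictAnti_of_deriv_neg fun x => by
    rw [(hK.hasDerivAt_kernelTail x).deriv]; linarith [hK.pos x]

lemma kernelTail_pos (hK : KernelConditions K) (x : ℝ) : 0 < kernelTail K x :=
  (hK.kernelTail_nonneg (x + 1)).trans_lt (hK.kernelTail_strictAnti (by linarith))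

lemma tendsto_atTop (hK : KernelConditions K) : Tendsto K atTop (𝓝 0) := by
  have h1 : Tendsto (fun x => kernelTail K (x - 1)) atTop (𝓝 0) :=
    (tendsto_kernelTail K).comp (tendsto_atTop_add_const_right _ (-1) tendsto_id)
  refine squeeze_zero' (Eventually.of_forall fun x => (hK.pos x).le) ?_ h1
  filter_upwards [eventually_ge_atTop 1] with x hx
  have h2 := hK.kernelTail_eq_add (x - 1) x
  have h3 := hK.kernelTail_nonneg x
  have h4 : ∫ t in (x - 1)..x, K x ≤ ∫ t in (x - 1)..x, K t := by
    apply intervalIntegral.integral_mono_on (by linarith) (by simp)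
      (hK.continuous.intervalIntegrable _ _)
    intro t ht
    apply hK.le_of_abs_le
    rw [abs_of_nonneg (by linarith [ht.1]), abs_of_nonneg (by linarith)]
    exact ht.2
  simp at h4
  linarith

/-- The first moment of `K` controls the integral of its tail, by integration by parts. -/
lemma integrableOn_kernelTail (hK : KernelConditions K) :
    IntegrableOn (kernelTail K) (Ioi 0) := by
  refine integrableOn_Ioi_of_intervalIntegral_norm_bounded (∫ s in Ioi (0 : ℝ), s * K s) 0
    (l := atTop) (b := id) (fun i => (hK.continuous_kernelTail.integrableOn_Icc).mono_set
      Ioc_subset_Icc_self) tendsto_id ?_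
  filter_upwards [eventually_ge_atTop 0] with A hA
  have hparts : ∫ x in (0 : ℝ)..A, kernelTail K x
      = A * kernelTail K A + ∫ s in (0 : ℝ)..A, s * K s := by
    have := intervalIntegral.integral_mul_deriv_eq_deriv_mul (a := 0) (b := A)
      (u := kernelTail K) (u' := fun x => -K x) (v := fun x => x) (v' := fun _ => 1)
      (fun x _ => hK.hasDerivAt_kernelTail x) (fun x _ => hasDerivAt_id' x)
      (hK.continuous.neg.intervalIntegrable _ _) (by simp)
    simp only [mul_one, mul_zero, sub_zero, neg_mul, intervalIntegral.integral_neg] at this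
    rw [this, mul_comm (kernelTail K A)]
    simp only [mul_comm (K _)]
    ring
  have htail : A * kernelTail K A ≤ ∫ s in Ioi A, s * K s := by
    rw [kernelTail, ← integral_const_mul]
    refine setIntegral_mono_on (hK.integrable.integrableOn.const_mul _)
      (hK.moment.mono_set (Ioi_subset_Ioi hA)) measurableSet_Ioi fun s hs => ?_
    exact mul_le_mul_of_nonneg_right (le_of_lt hs) (hK.pos s).le
  have hsplit := intervalIntegral.integral_Ioi_sub_Ioi' (a := 0) (b := A)
    (f := fun s => s * K s) (μ := volume) hK.moment (hK.moment.mono_set (Ioi_subset_Ioi hA))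
  have hn : ∀ x, ‖kernelTail K x‖ = kernelTail K x := fun x =>
    Real.norm_of_nonneg (hK.kernelTail_nonneg x)
  simp only [hn, id]
  linarith

lemma diffKernel_comm (hK : KernelConditions K) (x t : ℝ) :
    diffKernel K x t = diffKernel K t x := by
  rw [diffKernel, diffKernel, ← hK.even (x - t), neg_sub, add_comm]

lemma diffKernel_zero_left (hK : KernelConditions K) (t : ℝ) : diffKernel K 0 t = 0 := by
  rw [diffKernel, zero_sub, hK.even, zero_add, sub_self]

lemma diffKernel_nonneg (hK : KernelConditions K) {x t : ℝ} (hx : 0 ≤ x) (ht : 0 ≤ t) :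
    0 ≤ diffKernel K x t :=
  sub_nonneg.2 <| hK.le_of_abs_le <| abs_le_abs (by linarith) (by linarith)

lemma diffKernel_pos (hK : KernelConditions K) {x t : ℝ} (hx : 0 < x) (ht : 0 < t) :
    0 < diffKernel K x t := by
  refine sub_pos.2 <| hK.lt_of_abs_lt ?_
  rw [abs_of_pos (add_pos hx ht), abs_lt]
  constructor <;> linarith

lemma diffKernel_le_sub (hK : KernelConditions K) (x t : ℝ) :
    diffKernel K x t ≤ K (x - t) := by
  have := hK.pos (x + t)
  rw [diffKernel]; linarith

lemma diffKernel_le (hK : KernelConditions K) (x t : ℝ) : diffKernel K x t ≤ K 0 :=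
  (hK.diffKernel_le_sub x t).trans (hK.le_zero _)

lemma abs_diffKernel_le (hK : KernelConditions K) (x t : ℝ) : |diffKernel K x t| ≤ K 0 := by
  have h1 := hK.pos (x - t)
  have h2 := hK.le_zero (x + t)
  rw [abs_le]
  refine ⟨?_, hK.diffKernel_le x t⟩
  rw [diffKernel]; linarith

/-- Away from the origin the kernel is bounded below near the diagonal, uniformly. -/
lemma le_diffKernel (hK : KernelConditions K) {x t : ℝ} (h1 : |x - t| ≤ 2) (h2 : 4 ≤ x + t) :
    K 2 - K 4 ≤ diffKernel K x t := by
  have h3 : K 2 ≤ K (x - t) := hK.le_of_abs_le (by simpa using h1)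
  have h4 : K (x + t) ≤ K 4 := hK.le_of_abs_le <| by
    rw [abs_of_pos (by norm_num : (0 : ℝ) < 4), abs_of_pos (by linarith)]; exact h2
  rw [diffKernel]; linarith

lemma continuous_diffKernel (hK : KernelConditions K) :
    Continuous fun p : ℝ × ℝ => diffKernel K p.1 p.2 := by
  have := hK.continuous
  unfold diffKernel
  fun_prop

lemma tendsto_diffKernel (hK : KernelConditions K) (t : ℝ) :
    Tendsto (fun x => diffKernel K x t) atTop (𝓝 0) := by
  have h1 : Tendsto (fun x => K (x - t)) atTop (𝓝 0) :=
    hK.tendsto_atTop.comp (tendsto_atTop_add_const_right _ (-t) tendsto_id)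
  have h2 : Tendsto (fun x => K (x + t)) atTop (𝓝 0) :=
    hK.tendsto_atTop.comp (tendsto_atTop_add_const_right _ t tendsto_id)
  simpa [diffKernel] using h1.sub h2

lemma integrable_diffKernel (hK : KernelConditions K) (x : ℝ) :
    Integrable fun t => diffKernel K x t :=
  (hK.integrable.comp_sub_left x).sub (hK.integrable.comp_add_left x)

lemma integral_Ioi_comp_sub (hK : KernelConditions K) (a x : ℝ) :
    ∫ t in Ioi a, K (x - t) = kernelTail K (a - x) := by
  rw [kernelTail, sub_eq_add_neg, ← setIntegral_Ioi_comp_add_right]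
  congr 1 with t
  rw [← hK.even]; congr 1; ring

lemma integral_diffKernel (hK : KernelConditions K) (a x : ℝ) :
    ∫ t in Ioi a, diffKernel K x t = kernelTail K (a - x) - kernelTail K (a + x) := by
  unfold diffKernel
  rw [integral_sub (hK.integrable.comp_sub_left x).integrableOn
    (hK.integrable.comp_add_left x).integrableOn, hK.integral_Ioi_comp_sub]
  congr 1
  rw [kernelTail, ← setIntegral_Ioi_comp_add_right]
  simp only [add_comm]

lemma integral_diffKernel_zero (hK : KernelConditions K) (x : ℝ) :
    ∫ t in Ioi 0, diffKernel K x t = 1 - 2 * kernelTail K x := by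
  rw [hK.integral_diffKernel, zero_sub, hK.kernelTail_neg, zero_add]
  ring

end KernelConditions

/-! ### The integral operator -/

/-- The functions to which the integral operator is applied: measurable on `(0, ∞)` and dominated
there by the sum of a constant and an integrable function. -/
structure Admissible (h : ℝ → ℝ) : Prop where
  meas : AEStronglyMeasurable h (volume.restrict (Ioi 0))
  bound : ∃ c, ∃ g : ℝ → ℝ, 0 ≤ c ∧ IntegrableOn g (Ioi 0) ∧ ∀ t, 0 < t → |h t| ≤ c + |g t|

/-- The integral operator `h ↦ ∫₀^∞ (K(x - t) - K(x + t)) h(t) dt`. -/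
noncomputable def kernelOp (K h : ℝ → ℝ) (x : ℝ) : ℝ :=
  ∫ t in Ioi 0, diffKernel K x t * h t

lemma ae_Ioi_of_forall {p : ℝ → Prop} (h : ∀ t, 0 < t → p t) :
    ∀ᵐ t ∂(volume.restrict (Ioi (0 : ℝ))), p t :=
  (ae_restrict_iff' measurableSet_Ioi).2 (Eventually.of_forall fun t ht => h t ht)

namespace Admissible

variable {h h₁ h₂ : ℝ → ℝ}

lemma of_integrableOn (hh : IntegrableOn h (Ioi 0)) : Admissible h :=
  ⟨hh.1, 0, h, le_rfl, hh, fun t _ => by simp⟩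

lemma of_bounded (hh : AEStronglyMeasurable h (volume.restrict (Ioi 0))) {c : ℝ}
    (hc : ∀ t, 0 < t → |h t| ≤ c) : Admissible h :=
  ⟨hh, |c|, 0, abs_nonneg c, integrableOn_zero, fun t ht => by
    simpa using (hc t ht).trans (le_abs_self c)⟩

lemma const (c : ℝ) : Admissible fun _ => c :=
  of_bounded aestronglyMeasurable_const (c := |c|) fun _ _ => le_rfl

lemma mono' (hh : Admissible h₂) (hm : AEStronglyMeasurable h₁ (volume.restrict (Ioi 0)))
    (hle : ∀ t, 0 < t → |h₁ t| ≤ |h₂ t|) : Admissible h₁ := by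
  obtain ⟨c, g, hc, hg, hb⟩ := hh.bound
  exact ⟨hm, c, g, hc, hg, fun t ht => (hle t ht).trans (hb t ht)⟩

lemma add (hh₁ : Admissible h₁) (hh₂ : Admissible h₂) :
    Admissible fun t => h₁ t + h₂ t := by
  obtain ⟨c₁, g₁, hc₁, hg₁, hb₁⟩ := hh₁.bound
  obtain ⟨c₂, g₂, hc₂, hg₂, hb₂⟩ := hh₂.bound
  refine ⟨hh₁.meas.add hh₂.meas, c₁ + c₂, fun t => |g₁ t| + |g₂ t|, by positivity,
    hg₁.abs.add hg₂.abs, fun t ht => ?_⟩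
  have h1 := hb₁ t ht
  have h2 := hb₂ t ht
  have h3 := abs_add_le (h₁ t) (h₂ t)
  have h4 := le_abs_self (|g₁ t| + |g₂ t|)
  linarith

lemma const_mul (hh : Admissible h) (a : ℝ) : Admissible fun t => a * h t := by
  obtain ⟨c, g, hc, hg, hb⟩ := hh.bound
  refine ⟨hh.meas.const_mul a, |a| * c, fun t => a * g t, by positivity, hg.const_mul a,
    fun t ht => ?_⟩
  rw [abs_mul, abs_mul, ← mul_add]
  exact mul_le_mul_of_nonneg_left (hb t ht) (abs_nonneg a)

lemma sub (hh₁ : Admissible h₁) (hh₂ : Admissible h₂) :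
    Admissible fun t => h₁ t - h₂ t := by
  simpa [sub_eq_add_neg] using hh₁.add (hh₂.const_mul (-1))

lemma abs (hh : Admissible h) : Admissible fun t => |h t| :=
  hh.mono' hh.meas.norm fun t _ => by simp

lemma integrableOn_Ioc (hh : Admissible h) (R : ℝ) : IntegrableOn h (Ioc 0 R) := by
  obtain ⟨c, g, hc, hg, hb⟩ := hh.bound
  have hs : Ioc (0 : ℝ) R ⊆ Ioi 0 := fun t ht => ht.1
  refine Integrable.mono' (g := fun t => c + |g t|)
    ((integrable_const c).add (hg.mono_set hs).abs)
    (hh.meas.mono_measure (Measure.restrict_mono hs le_rfl)) ?_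
  exact (ae_restrict_iff' measurableSet_Ioc).2 (Eventually.of_forall fun t ht => hb t ht.1)

lemma integrableOn_mul (hh : Admissible h) {κ : ℝ → ℝ} {C : ℝ} (hκ : IntegrableOn κ (Ioi 0))
    (hC : ∀ t, 0 < t → |κ t| ≤ C) : IntegrableOn (fun t => κ t * h t) (Ioi 0) := by
  obtain ⟨c, g, hc, hg, hb⟩ := hh.bound
  refine Integrable.mono' (g := fun t => |κ t| * c + C * |g t|)
    ((hκ.abs.mul_const c).add (hg.abs.const_mul _))
    (hκ.1.mul hh.meas) (ae_Ioi_of_forall fun t ht => ?_)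
  rw [Real.norm_eq_abs, abs_mul]
  calc _ ≤ |κ t| * (c + |g t|) :=
        mul_le_mul_of_nonneg_left (hb t ht) (abs_nonneg _)
    _ ≤ _ := by
        rw [mul_add]
        gcongr
        exact hC t ht

end Admissible

namespace KernelConditions

variable {K h h₁ h₂ g : ℝ → ℝ}

lemma integrableOn_mul (hK : KernelConditions K) (hh : Admissible h) (x : ℝ) :
    IntegrableOn (fun t => diffKernel K x t * h t) (Ioi 0) :=
  hh.integrableOn_mul (hK.integrable_diffKernel x).integrableOn fun t _ => hK.abs_diffKernel_le x t

lemma kernelOp_mono (hK : KernelConditions K) (hh₁ : Admissible h₁) (hh₂ : Admissible h₂)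
    (hle : ∀ t, 0 < t → h₁ t ≤ h₂ t) {x : ℝ} (hx : 0 ≤ x) :
    kernelOp K h₁ x ≤ kernelOp K h₂ x :=
  setIntegral_mono_on (hK.integrableOn_mul hh₁ x) (hK.integrableOn_mul hh₂ x) measurableSet_Ioi
    fun t ht => mul_le_mul_of_nonneg_left (hle t ht) (hK.diffKernel_nonneg hx (le_of_lt ht))

lemma kernelOp_nonneg (hK : KernelConditions K) (hh : ∀ t, 0 < t → 0 ≤ h t) {x : ℝ}
    (hx : 0 ≤ x) : 0 ≤ kernelOp K h x :=
  setIntegral_nonneg measurableSet_Ioi fun t ht =>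
    mul_nonneg (hK.diffKernel_nonneg hx (le_of_lt ht)) (hh t ht)

lemma kernelOp_zero (hK : KernelConditions K) : kernelOp K h 0 = 0 := by
  simp [kernelOp, hK.diffKernel_zero_left]

lemma kernelOp_add (hK : KernelConditions K) (hh₁ : Admissible h₁) (hh₂ : Admissible h₂)
    (x : ℝ) : kernelOp K (fun t => h₁ t + h₂ t) x = kernelOp K h₁ x + kernelOp K h₂ x := by
  simp only [kernelOp, mul_add]
  exact integral_add (hK.integrableOn_mul hh₁ x) (hK.integrableOn_mul hh₂ x)

lemma kernelOp_sub (hK : KernelConditions K) (hh₁ : Admissible h₁) (hh₂ : Admissible h₂)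
    (x : ℝ) : kernelOp K (fun t => h₁ t - h₂ t) x = kernelOp K h₁ x - kernelOp K h₂ x := by
  simp only [kernelOp, mul_sub]
  exact integral_sub (hK.integrableOn_mul hh₁ x) (hK.integrableOn_mul hh₂ x)

end KernelConditions

lemma kernelOp_const_mul (K h : ℝ → ℝ) (a x : ℝ) :
    kernelOp K (fun t => a * h t) x = a * kernelOp K h x := by
  simp only [kernelOp, ← integral_const_mul]
  congr 1 with t; ring

namespace KernelConditions

variable {K h h₁ h₂ g : ℝ → ℝ}

lemma kernelOp_const (hK : KernelConditions K) (c x : ℝ) :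
    kernelOp K (fun _ => c) x = c * (1 - 2 * kernelTail K x) := by
  rw [← hK.integral_diffKernel_zero, kernelOp, integral_mul_const, mul_comm]

lemma kernelOp_const_le (hK : KernelConditions K) {c : ℝ} (hc : 0 ≤ c) (x : ℝ) :
    kernelOp K (fun _ => c) x ≤ c := by
  rw [hK.kernelOp_const]
  nlinarith [hK.kernelTail_nonneg x]

lemma abs_kernelOp_le (hK : KernelConditions K) {x : ℝ} (hx : 0 ≤ x) :
    |kernelOp K h x| ≤ kernelOp K (fun t => |h t|) x := by
  refine abs_integral_le_integral_abs.trans_eq ?_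
  refine setIntegral_congr_fun measurableSet_Ioi fun t ht => ?_
  simp only [abs_mul, abs_of_nonneg (hK.diffKernel_nonneg hx (le_of_lt ht))]

lemma kernelOp_le_integral (hK : KernelConditions K) (hg : IntegrableOn g (Ioi 0))
    (hg0 : ∀ t, 0 < t → 0 ≤ g t) (x : ℝ) :
    kernelOp K g x ≤ K 0 * ∫ t in Ioi 0, g t := by
  rw [← integral_const_mul]
  exact setIntegral_mono_on (hK.integrableOn_mul (.of_integrableOn hg) x) (hg.const_mul _)
    measurableSet_Ioi fun t ht => mul_le_mul_of_nonneg_right (hK.diffKernel_le x t) (hg0 t ht)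

lemma exists_kernelOp_le (hK : KernelConditions K) (hh : Admissible h) :
    ∃ C, ∀ x, 0 ≤ x → kernelOp K h x ≤ C := by
  obtain ⟨c, g, hc, hg, hb⟩ := hh.bound
  refine ⟨c + K 0 * ∫ t in Ioi 0, |g t|, fun x hx => ?_⟩
  calc _ ≤ kernelOp K (fun t => c + |g t|) x :=
        hK.kernelOp_mono hh ((Admissible.const c).add (.of_integrableOn hg.abs))
          (fun t ht => (le_abs_self _).trans (hb t ht)) hx
    _ = kernelOp K (fun _ => c) x + kernelOp K (fun t => |g t|) x :=
        hK.kernelOp_add (.const c) (.of_integrableOn hg.abs) x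
    _ ≤ _ := add_le_add (hK.kernelOp_const_le hc x)
        (hK.kernelOp_le_integral hg.abs (fun t _ => abs_nonneg _) x)

/-- Translates of `K` by bounded amounts have a common integrable majorant. -/
lemma integrableOn_majorant (hK : KernelConditions K) {R : ℝ} (hR : 0 ≤ R) :
    IntegrableOn (fun t => K (max (t - R) 0)) (Ioi 0) := by
  have hc : Continuous fun t => K (max (t - R) 0) := by
    have := hK.continuous; fun_prop
  rw [← Ioc_union_Ioi_eq_Ioi hR]
  refine (hc.integrableOn_Icc.mono_set Ioc_subset_Icc_self).union ?_
  refine IntegrableOn.congr_fun (f := fun t => K (t - R))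
    (hK.integrable.comp_sub_right R).integrableOn (fun t ht => ?_) measurableSet_Ioi
  simp only [max_eq_left (sub_nonneg.2 (le_of_lt (mem_Ioi.1 ht)))]

lemma le_majorant (hK : KernelConditions K) {x R : ℝ} (hx : |x| ≤ R) (t : ℝ) :
    K (x - t) ≤ K (max (t - R) 0) ∧ K (x + t) ≤ K (max (t - R) 0) := by
  have := abs_le.1 hx
  constructor <;> apply hK.le_of_abs_le <;>
    rw [abs_of_nonneg (le_max_right _ _)] <;> refine max_le ?_ (abs_nonneg _)
  · rw [abs_sub_comm]; exact le_trans (by linarith) (le_abs_self _)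
  · exact le_trans (by linarith) (le_abs_self _)

lemma continuous_kernelOp (hK : KernelConditions K) (hh : Admissible h) :
    Continuous (kernelOp K h) := by
  obtain ⟨c, g, hc, hg, hb⟩ := hh.bound
  refine continuous_iff_continuousAt.2 fun x₀ => ?_
  have hR : 0 ≤ |x₀| + 1 := by positivity
  refine continuousAt_of_dominated
    (bound := fun t => 2 * K (max (t - (|x₀| + 1)) 0) * c + K 0 * |g t|)
    (Eventually.of_forall fun x => (hK.integrableOn_mul hh x).1) ?_
    ((((hK.integrableOn_majorant hR).const_mul 2).mul_const c).add (hg.abs.const_mul _))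
    (Eventually.of_forall fun t => ?_)
  · filter_upwards [Metric.ball_mem_nhds x₀ one_pos] with x hx
    have hx' : |x| ≤ |x₀| + 1 := by
      rw [Metric.mem_ball, Real.dist_eq] at hx
      have := abs_sub_abs_le_abs_sub x x₀
      linarith
    refine ae_Ioi_of_forall fun t ht => ?_
    obtain ⟨h1, h2⟩ := hK.le_majorant hx' t
    have h3 : |diffKernel K x t| ≤ 2 * K (max (t - (|x₀| + 1)) 0) := by
      have := hK.pos (x - t)
      have := hK.pos (x + t)
      rw [diffKernel, abs_le]; constructor <;> linarith
    rw [Real.norm_eq_abs, abs_mul]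
    calc _ ≤ |diffKernel K x t| * (c + |g t|) :=
          mul_le_mul_of_nonneg_left (hb t ht) (abs_nonneg _)
      _ ≤ _ := by
          rw [mul_add]
          gcongr
          exact hK.abs_diffKernel_le x t
  · have : Continuous fun x => diffKernel K x t :=
      hK.continuous_diffKernel.comp (continuous_id.prodMk continuous_const)
    exact (this.mul continuous_const).continuousAt

lemma tendsto_kernelOp_zero (hK : KernelConditions K) (hg : IntegrableOn g (Ioi 0)) :
    Tendsto (kernelOp K g) atTop (𝓝 0) := by
  have : Tendsto (kernelOp K g) atTop (𝓝 (∫ t in Ioi (0 : ℝ), 0 * g t)) := by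
    refine tendsto_integral_filter_of_dominated_convergence (fun t => K 0 * |g t|)
      (Eventually.of_forall fun x => (hK.integrableOn_mul (.of_integrableOn hg) x).1)
      (Eventually.of_forall fun x => Eventually.of_forall fun t => ?_) (hg.abs.const_mul _)
      (Eventually.of_forall fun t => (hK.tendsto_diffKernel t).mul_const _)
    rw [Real.norm_eq_abs, abs_mul]
    exact mul_le_mul_of_nonneg_right (hK.abs_diffKernel_le x t) (abs_nonneg _)
  simpa using this

lemma eventually_kernelOp_le (hK : KernelConditions K) (hh : Admissible h) {a δ : ℝ}
    (ha : 0 ≤ a) (hδ : 0 < δ) (hle : ∀ᶠ t in atTop, h t ≤ a) :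
    ∀ᶠ x in atTop, kernelOp K h x ≤ a + δ := by
  obtain ⟨R, hR⟩ := eventually_atTop.1 hle
  have hg : IntegrableOn ((Ioc 0 R).indicator fun t => |h t|) (Ioi 0) :=
    ((hh.abs.integrableOn_Ioc R).integrable_indicator measurableSet_Ioc).integrableOn
  filter_upwards [(hK.tendsto_kernelOp_zero hg).eventually_lt_const hδ, eventually_ge_atTop 0]
    with x hx hx0
  calc _ ≤ kernelOp K (fun t => a + (Ioc 0 R).indicator (fun t => |h t|) t) x := by
        refine hK.kernelOp_mono hh ((Admissible.const a).add (.of_integrableOn hg))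
          (fun t ht => ?_) hx0
        by_cases htR : t ≤ R
        · rw [indicator_of_mem (show t ∈ Ioc 0 R from ⟨ht, htR⟩)]
          linarith [le_abs_self (h t)]
        · rw [indicator_of_notMem (fun h => htR h.2), add_zero]
          exact hR t (le_of_not_ge htR)
    _ = kernelOp K (fun _ => a) x + _ := hK.kernelOp_add (.const a) (.of_integrableOn hg) x
    _ ≤ _ := add_le_add (hK.kernelOp_const_le ha x) hx.le

lemma eventually_le_kernelOp (hK : KernelConditions K) (hh : Admissible h) {a δ : ℝ}
    (hδ : 0 < δ) (hle : ∀ᶠ t in atTop, a ≤ h t) :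
    ∀ᶠ x in atTop, a - δ ≤ kernelOp K h x := by
  obtain ⟨R, hR⟩ := eventually_atTop.1 hle
  have hd := ((Admissible.const a).sub hh)
  have hg : IntegrableOn ((Ioc 0 R).indicator fun t => |a - h t|) (Ioi 0) :=
    ((hd.abs.integrableOn_Ioc R).integrable_indicator measurableSet_Ioc).integrableOn
  have hlim : Tendsto (fun x => a * (1 - 2 * kernelTail K x)
      - kernelOp K ((Ioc 0 R).indicator fun t => |a - h t|) x) atTop (𝓝 a) := by
    have := (((tendsto_kernelTail K).const_mul 2).const_sub 1).const_mul a |>.sub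
      (hK.tendsto_kernelOp_zero hg)
    simpa using this
  filter_upwards [hlim.eventually_const_lt (show a - δ < a by linarith), eventually_ge_atTop 0]
    with x hx hx0
  refine hx.le.trans ?_
  rw [← hK.kernelOp_const, ← hK.kernelOp_sub (.const a) (.of_integrableOn hg)]
  refine hK.kernelOp_mono ((Admissible.const a).sub (.of_integrableOn hg)) hh (fun t ht => ?_) hx0
  by_cases htR : t ≤ R
  · rw [indicator_of_mem (show t ∈ Ioc 0 R from ⟨ht, htR⟩)]
    linarith [le_abs_self (a - h t)]
  · rw [indicator_of_notMem (fun h => htR h.2), sub_zero]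
    exact hR t (le_of_not_ge htR)

lemma ae_eq_zero_of_kernelOp_eq_zero (hK : KernelConditions K) (hh : Admissible h)
    (hh0 : ∀ t, 0 < t → 0 ≤ h t) {x : ℝ} (hx : 0 < x) (h0 : kernelOp K h x = 0) :
    h =ᵐ[volume.restrict (Ioi 0)] 0 := by
  have h1 := (integral_eq_zero_iff_of_nonneg_ae
    (ae_Ioi_of_forall fun t ht => mul_nonneg (hK.diffKernel_nonneg hx.le ht.le) (hh0 t ht))
    (hK.integrableOn_mul hh x)).1 h0
  filter_upwards [h1, ae_restrict_mem measurableSet_Ioi] with t ht ht0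
  exact (mul_eq_zero.1 ht).resolve_left (hK.diffKernel_pos hx ht0).ne'

lemma integrable_prod (hK : KernelConditions K) {m : ℝ → ℝ} (hm : Admissible m)
    (hm0 : ∀ t, 0 < t → 0 ≤ m t) (hg : IntegrableOn g (Ioi 0)) :
    Integrable (fun p : ℝ × ℝ => diffKernel K p.1 p.2 * m p.1 * g p.2)
      ((volume.restrict (Ioi 0)).prod (volume.restrict (Ioi 0))) := by
  have hmeas : AEStronglyMeasurable (fun p : ℝ × ℝ => diffKernel K p.1 p.2 * m p.1 * g p.2)
      ((volume.restrict (Ioi 0)).prod (volume.restrict (Ioi 0))) :=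
    (hK.continuous_diffKernel.aestronglyMeasurable.mul hm.meas.comp_fst).mul hg.1.comp_snd
  rw [integrable_prod_iff' hmeas]
  constructor
  · refine Eventually.of_forall fun t => ?_
    have := hK.integrableOn_mul hm t
    simp only [hK.diffKernel_comm t] at this
    exact Integrable.mul_const this (g t)
  · obtain ⟨C, hC⟩ := hK.exists_kernelOp_le hm
    refine Integrable.mono' (g := fun t => C * |g t|) (hg.abs.const_mul C)
      hmeas.norm.prod_swap.integral_prod_right' (ae_Ioi_of_forall fun t ht => ?_)
    have h1 : ∫ x in Ioi (0 : ℝ), ‖diffKernel K x t * m x * g t‖ = kernelOp K m t * |g t| := by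
      rw [kernelOp, ← integral_mul_const]
      refine setIntegral_congr_fun measurableSet_Ioi fun x hx => ?_
      simp only [Real.norm_eq_abs]
      rw [abs_mul, abs_of_nonneg (mul_nonneg (hK.diffKernel_nonneg (le_of_lt hx) ht.le)
        (hm0 x hx)), hK.diffKernel_comm]
    rw [h1, Real.norm_of_nonneg (mul_nonneg (hK.kernelOp_nonneg hm0 ht.le) (abs_nonneg _))]
    exact mul_le_mul_of_nonneg_right (hC t ht.le) (abs_nonneg _)

lemma integrableOn_kernelOp (hK : KernelConditions K) (hg : IntegrableOn g (Ioi 0)) :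
    IntegrableOn (kernelOp K g) (Ioi 0) := by
  have := (hK.integrable_prod (.const 1) (fun _ _ => zero_le_one) hg).integral_prod_left
  simp only [mul_one] at this
  exact this

lemma integral_kernelOp_le (hK : KernelConditions K) (hg : IntegrableOn g (Ioi 0))
    (hg0 : ∀ t, 0 < t → 0 ≤ g t) :
    ∫ x in Ioi 0, kernelOp K g x ≤ ∫ t in Ioi 0, g t := by
  have hp := hK.integrable_prod (.const 1) (fun _ _ => zero_le_one) hg
  have hswap := integral_integral_swap
    (f := fun x t => diffKernel K x t * 1 * g t) hp
  simp only [mul_one] at hswap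
  unfold kernelOp
  rw [hswap]
  have hp' := hp.integral_prod_right
  simp only [mul_one] at hp'
  refine setIntegral_mono_on hp' hg measurableSet_Ioi fun t ht => ?_
  rw [integral_mul_const]
  simp only [hK.diffKernel_comm _ t]
  rw [hK.integral_diffKernel_zero]
  nlinarith [hK.kernelTail_nonneg t, hg0 t ht]

/-- A bounded function that near infinity is dominated, up to an integrable error, by `q⁻¹ < 1`
times its image under the operator is integrable. The mass that the operator moves from `(A, ∞)`
into `(0, A)` is at most the bound of the function times `∫ x in (0, ∞), kernelTail K x`, whatever
`A` is. -/
lemma integrableOn_of_le_kernelOp (hK : KernelConditions K) {w : ℝ → ℝ} {q c R : ℝ}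
    (hwm : AEStronglyMeasurable w (volume.restrict (Ioi 0)))
    (hw0 : ∀ t, 0 < t → 0 ≤ w t) (hwc : ∀ t, 0 < t → w t ≤ c) (hq : 1 < q) (hR : 0 ≤ R)
    (hg : IntegrableOn g (Ioi 0)) (hle : ∀ x, R ≤ x → q * w x ≤ kernelOp K w x + g x) :
    IntegrableOn w (Ioi 0) := by
  have hc : 0 ≤ c := (hw0 1 one_pos).trans (hwc 1 one_pos)
  have hadm : Admissible w := .of_bounded hwm (c := c) fun t ht => by
    rw [abs_of_nonneg (hw0 t ht)]; exact hwc t ht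
  have hloc : ∀ A, IntegrableOn w (Ioc 0 A) := hadm.integrableOn_Ioc
  set D := (∫ t in Ioc 0 R, w t) + c * (∫ s in Ioi 0, kernelTail K s) + ∫ t in Ioi 0, |g t|
  rw [← Ioc_union_Ioi_eq_Ioi hR]
  refine (hloc R).union ?_
  refine integrableOn_Ioi_of_intervalIntegral_norm_bounded (D / (q - 1)) R
    (l := atTop) (b := id) (fun A => (hloc A).mono_set (Ioc_subset_Ioc_left hR)) tendsto_id ?_
  filter_upwards [eventually_ge_atTop R] with A hA
  have hA0 : 0 ≤ A := hR.trans hA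
  have hRA : Ioc R A ⊆ Ioi 0 := fun t ht => hR.trans_lt ht.1
  have h0A : Ioc 0 A ⊆ Ioi 0 := fun t ht => ht.1
  set w₁ := (Ioc 0 A).indicator w
  have hw₁ : IntegrableOn w₁ (Ioi 0) :=
    ((hloc A).integrable_indicator measurableSet_Ioc).integrableOn
  have hw₁0 : ∀ t, 0 < t → 0 ≤ w₁ t := fun t ht => by
    exact indicator_nonneg (fun s hs => hw0 s hs.1) t
  have hpt : ∀ x ∈ Ioc R A, q * w x ≤ kernelOp K w₁ x + c * kernelTail K (A - x) + |g x| := by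
    intro x hx
    have hx0 : 0 ≤ x := hR.trans hx.1.le
    have hw₂ : Admissible fun t => w t - w₁ t := hadm.sub (.of_integrableOn hw₁)
    have h1 : kernelOp K w x = kernelOp K w₁ x + kernelOp K (fun t => w t - w₁ t) x := by
      rw [← hK.kernelOp_add (.of_integrableOn hw₁) hw₂]; simp
    have h2 : kernelOp K (fun t => w t - w₁ t) x ≤ c * kernelTail K (A - x) := by
      rw [← hK.integral_Ioi_comp_sub, ← integral_const_mul, kernelOp]
      rw [← Ioc_union_Ioi_eq_Ioi hA0, setIntegral_union (Ioc_disjoint_Ioi le_rfl)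
        measurableSet_Ioi ((hK.integrableOn_mul hw₂ x).mono_set h0A)
        ((hK.integrableOn_mul hw₂ x).mono_set (Ioi_subset_Ioi hA0))]
      rw [setIntegral_congr_fun (g := fun _ => 0) measurableSet_Ioc (fun t ht => by
        simp [w₁, indicator_of_mem ht])]
      rw [integral_zero, zero_add]
      refine setIntegral_mono_on ((hK.integrableOn_mul hw₂ x).mono_set (Ioi_subset_Ioi hA0))
        ((hK.integrable.comp_sub_left x).integrableOn.const_mul c) measurableSet_Ioi
        fun t ht => ?_
      have ht0 : 0 < t := hA0.trans_lt ht
      have : w₁ t = 0 := indicator_of_notMem (fun h => not_le_of_gt ht h.2) _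
      rw [this, sub_zero, mul_comm c]
      exact mul_le_mul (hK.diffKernel_le_sub x t) (hwc t ht0) (hw0 t ht0) (hK.pos _).le
    linarith [hle x hx.1.le, le_abs_self (g x)]
  have hga : IntegrableOn (fun t => |g t|) (Ioi 0) := hg.abs
  have hi1 := (hK.integrableOn_kernelOp hw₁)
  have hct : Continuous fun x => kernelTail K (A - x) :=
    hK.continuous_kernelTail.comp (continuous_const.sub continuous_id)
  have hi2 : IntegrableOn (fun x => c * kernelTail K (A - x)) (Ioc R A) :=
    (hct.integrableOn_Icc.mono_set Ioc_subset_Icc_self).const_mul c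
  have hi12 : IntegrableOn (fun x => kernelOp K w₁ x + c * kernelTail K (A - x)) (Ioc R A) :=
    (hi1.mono_set hRA).add hi2
  have hint : q * ∫ x in Ioc R A, w x ≤
      (∫ x in Ioc R A, kernelOp K w₁ x) + (∫ x in Ioc R A, c * kernelTail K (A - x))
        + ∫ x in Ioc R A, |g x| := by
    rw [← integral_const_mul, ← integral_add (hi1.mono_set hRA) hi2,
      ← integral_add hi12 (hga.mono_set hRA)]
    exact setIntegral_mono_on (((hloc A).mono_set (Ioc_subset_Ioc_left hR)).const_mul q)
      (hi12.add (hga.mono_set hRA)) measurableSet_Ioc hpt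
  have e1 : ∫ x in Ioc R A, kernelOp K w₁ x ≤ ∫ t in Ioc 0 A, w t := by
    calc _ ≤ ∫ x in Ioi 0, kernelOp K w₁ x :=
          setIntegral_mono_set hi1 (ae_Ioi_of_forall fun x hx => hK.kernelOp_nonneg hw₁0 hx.le)
            hRA.eventuallyLE
      _ ≤ ∫ t in Ioi 0, w₁ t := hK.integral_kernelOp_le hw₁ hw₁0
      _ = _ := by rw [setIntegral_indicator measurableSet_Ioc, inter_eq_self_of_subset_right h0A]
  have e2 : ∫ x in Ioc R A, c * kernelTail K (A - x) ≤ c * ∫ s in Ioi 0, kernelTail K s := by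
    rw [integral_const_mul]
    refine mul_le_mul_of_nonneg_left ?_ hc
    rw [← intervalIntegral.integral_of_le hA, intervalIntegral.integral_comp_sub_left, sub_self,
      intervalIntegral.integral_of_le (by linarith)]
    exact setIntegral_mono_set hK.integrableOn_kernelTail
      (ae_Ioi_of_forall fun x _ => hK.kernelTail_nonneg x)
      (show Ioc 0 (A - R) ⊆ Ioi 0 from fun t ht => ht.1).eventuallyLE
  have e3 : ∫ x in Ioc R A, |g x| ≤ ∫ x in Ioi 0, |g x| :=
    setIntegral_mono_set hg.abs (ae_Ioi_of_forall fun x _ => abs_nonneg _) hRA.eventuallyLE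
  have e4 : ∫ t in Ioc 0 A, w t = (∫ t in Ioc 0 R, w t) + ∫ t in Ioc R A, w t := by
    rw [← Ioc_union_Ioc_eq_Ioc hR hA, setIntegral_union (Ioc_disjoint_Ioc_of_le le_rfl)
      measurableSet_Ioc (hloc R) ((hloc A).mono_set (Ioc_subset_Ioc_left hR))]
  have e5 : ∫ x in R..id A, ‖w x‖ = ∫ t in Ioc R A, w t := by
    rw [id, intervalIntegral.integral_of_le hA]
    exact setIntegral_congr_fun measurableSet_Ioc fun t ht =>
      Real.norm_of_nonneg (hw0 t (hRA ht))
  rw [e5, le_div_iff₀ (by linarith)]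
  simp only [D]
  linarith

/-- The operator is the convolution of `K` with the odd extension, so it preserves
monotonicity. -/
lemma monotone_kernelOp (hK : KernelConditions K) (hh : Admissible h)
    (hh0 : ∀ t, 0 < t → 0 ≤ h t) (hmono : MonotoneOn h (Ioi 0)) :
    Monotone (kernelOp K h) := by
  set H := (Ioi 0).indicator h
  have hH : Monotone H := by
    intro s t hst
    by_cases hs : 0 < s
    · have ht := hs.trans_le hst
      simp only [H, indicator_of_mem (show s ∈ Ioi 0 from hs),
        indicator_of_mem (show t ∈ Ioi 0 from ht)]
      exact hmono hs ht hst
    · have : H s = 0 := indicator_of_notMem hs h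
      rw [this]
      exact indicator_nonneg (fun r hr => hh0 r hr) t
  have hi1 : ∀ x, Integrable fun t => K (x - t) * H t := fun x => by
    have := (hh.integrableOn_mul (κ := fun t => K (x - t))
      (hK.integrable.comp_sub_left x).integrableOn (C := K 0)
      fun t _ => by rw [abs_of_pos (hK.pos _)]; exact hK.le_zero _).integrable_indicator
        measurableSet_Ioi
    refine this.congr (Eventually.of_forall fun t => ?_)
    simp only [H, indicator_mul_right]
  have hi2 : ∀ x, Integrable fun t => K (x + t) * H t := fun x => by
    have := (hh.integrableOn_mul (κ := fun t => K (x + t))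
      (hK.integrable.comp_add_left x).integrableOn (C := K 0)
      fun t _ => by rw [abs_of_pos (hK.pos _)]; exact hK.le_zero _).integrable_indicator
        measurableSet_Ioi
    refine this.congr (Eventually.of_forall fun t => ?_)
    simp only [H, indicator_mul_right]
  have hi1' : ∀ x, Integrable fun s => K s * H (x - s) := fun x => by
    simpa using (hi1 x).comp_sub_left x
  have hi2' : ∀ x, Integrable fun s => K s * H (s - x) := fun x => by
    simpa using (hi2 x).comp_sub_right x
  have hrepr : ∀ x, kernelOp K h x = ∫ s, K s * (H (x - s) - H (s - x)) := by
    intro x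
    have e1 : ∫ s, K s * H (x - s) = ∫ t, K (x - t) * H t := by
      simpa using (integral_sub_left_eq_self (fun t => K (x - t) * H t) volume x)
    have e2 : ∫ s, K s * H (s - x) = ∫ t, K (x + t) * H t := by
      simpa using (integral_sub_right_eq_self (fun t => K (x + t) * H t) x)
    simp only [mul_sub]
    rw [integral_sub (hi1' x) (hi2' x), e1, e2, ← integral_sub (hi1 x) (hi2 x), kernelOp,
      ← integral_indicator measurableSet_Ioi]
    congr 1 with t
    rw [indicator_mul_right, diffKernel, sub_mul]
  intro x y hxy
  rw [hrepr, hrepr]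
  have hint : ∀ x, Integrable fun s => K s * (H (x - s) - H (s - x)) := fun x => by
    simp only [mul_sub]
    exact (hi1' x).sub (hi2' x)
  refine integral_mono (hint x) (hint y) fun s => mul_le_mul_of_nonneg_left ?_ (hK.pos s).le
  exact sub_le_sub (hH (by linarith)) (hH (by linarith))

end KernelConditions

/-! ### The nonlinearity `Q` and the comparison function `φ` -/

lemma ConcaveOn.chord_le {s : Set ℝ} {f : ℝ → ℝ} (hf : ConcaveOn ℝ s f) {x y z : ℝ} (hx : x ∈ s)
    (hy : y ∈ s) (hxz : x ≤ z) (hzy : z ≤ y) :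
    f x * (y - z) + f y * (z - x) ≤ f z * (y - x) := by
  rcases hxz.eq_or_lt with rfl | hxz
  · simp
  rcases hzy.eq_or_lt with rfl | hzy
  · simp
  have hd : 0 < y - x := by linarith
  have h := hf.2 hx hy (show 0 ≤ (y - z) / (y - x) from div_nonneg (by linarith) hd.le)
    (show 0 ≤ (z - x) / (y - x) from div_nonneg (by linarith) hd.le) (by field_simp; ring)
  have e : (y - z) / (y - x) * x + (z - x) / (y - x) * y = z := by field_simp; ring
  simp only [smul_eq_mul] at h
  rw [e] at h
  calc _ = ((y - z) / (y - x) * f x + (z - x) / (y - x) * f y) * (y - x) := by field_simp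
    _ ≤ _ := mul_le_mul_of_nonneg_right h hd.le

namespace QConditions

variable {Q φ : ℝ → ℝ} {M ξ : ℝ}

lemma nonneg (hQ : QConditions Q M ξ φ) {v : ℝ} (hv : 0 ≤ v) : 0 ≤ Q v := by
  rw [← hQ.zero]
  exact hQ.strictMono.monotoneOn self_mem_Ici hv hv

lemma mul_le_mul (hQ : QConditions Q M ξ φ) {v w : ℝ} (hv : 0 ≤ v) (hvw : v ≤ w) (hw : 0 < w) :
    Q v * w ≤ Q w * v := by
  have h := hQ.convex.neg.chord_le (x := 0) (y := w) self_mem_Ici hw.le hv hvw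
  simp only [Pi.neg_apply, hQ.zero] at h
  linarith

lemma exists_eq (hQ : QConditions Q M ξ φ) (hM : 0 ≤ M) {y : ℝ} (hy : 0 ≤ y) :
    ∃ v ∈ Ici (0 : ℝ), Q v = y := by
  have hξ := hQ.xi_pos
  have hw : 0 ≤ max ξ y := hξ.le.trans (le_max_left _ _)
  have h1 : y ≤ Q (max ξ y) := by
    have h2 := hQ.mul_le_mul hξ.le (le_max_left ξ y) (hξ.trans_le (le_max_left _ _))
    rw [hQ.xi_eq, mul_assoc, mul_comm ξ, ← mul_assoc] at h2
    have h3 := le_of_mul_le_mul_right h2 hξ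
    nlinarith [le_max_right ξ y]
  obtain ⟨v, hv, hvy⟩ := intermediate_value_Icc hw (hQ.cont.mono Icc_subset_Ici_self)
    (show y ∈ Icc (Q 0) (Q (max ξ y)) from ⟨by rwa [hQ.zero], h1⟩)
  exact ⟨v, hv.1, hvy⟩

lemma inverse_nonneg (hQ : QConditions Q M ξ φ) (hM : 0 ≤ M) {y : ℝ} (hy : 0 ≤ y) :
    0 ≤ halfLineInverse Q y :=
  Function.invFunOn_mem (hQ.exists_eq hM hy)

lemma apply_inverse (hQ : QConditions Q M ξ φ) (hM : 0 ≤ M) {y : ℝ} (hy : 0 ≤ y) :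
    Q (halfLineInverse Q y) = y :=
  Function.invFunOn_eq (hQ.exists_eq hM hy)

lemma le_inverse_iff (hQ : QConditions Q M ξ φ) (hM : 0 ≤ M) {v y : ℝ} (hv : 0 ≤ v)
    (hy : 0 ≤ y) : v ≤ halfLineInverse Q y ↔ Q v ≤ y := by
  rw [← hQ.strictMono.le_iff_le hv (hQ.inverse_nonneg hM hy), hQ.apply_inverse hM hy]

lemma inverse_le_iff (hQ : QConditions Q M ξ φ) (hM : 0 ≤ M) {v y : ℝ} (hv : 0 ≤ v)
    (hy : 0 ≤ y) : halfLineInverse Q y ≤ v ↔ y ≤ Q v := by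
  rw [← hQ.strictMono.le_iff_le (hQ.inverse_nonneg hM hy) hv, hQ.apply_inverse hM hy]

lemma inverse_apply (hQ : QConditions Q M ξ φ) (hM : 0 ≤ M) {v : ℝ} (hv : 0 ≤ v) :
    halfLineInverse Q (Q v) = v :=
  le_antisymm ((hQ.inverse_le_iff hM hv (hQ.nonneg hv)).2 le_rfl)
    ((hQ.le_inverse_iff hM hv (hQ.nonneg hv)).2 le_rfl)

lemma inverse_mono (hQ : QConditions Q M ξ φ) (hM : 0 ≤ M) {y z : ℝ} (hy : 0 ≤ y)
    (hyz : y ≤ z) : halfLineInverse Q y ≤ halfLineInverse Q z := by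
  rw [hQ.le_inverse_iff hM (hQ.inverse_nonneg hM hy) (hy.trans hyz), hQ.apply_inverse hM hy]
  exact hyz

lemma continuousOn_inverse (hQ : QConditions Q M ξ φ) (hM : 0 ≤ M) :
    ContinuousOn (halfLineInverse Q) (Ici 0) := by
  -- Continued by the identity, the inverse is a monotone surjection of the line.
  set g : ℝ → ℝ := fun y => if 0 ≤ y then halfLineInverse Q y else y
  have hmono : Monotone g := by
    intro y z hyz
    simp only [g]
    split_ifs with hy hz hz
    · exact hQ.inverse_mono hM hy hyz
    · exact absurd (hy.trans hyz) hz
    · exact (le_of_not_ge hy).trans (hQ.inverse_nonneg hM hz)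
    · exact hyz
  have hsurj : Function.Surjective g := by
    intro v
    by_cases hv : 0 ≤ v
    · exact ⟨Q v, by simp only [g, if_pos (hQ.nonneg hv), hQ.inverse_apply hM hv]⟩
    · exact ⟨v, if_neg hv⟩
  refine (hmono.continuous_of_surjective hsurj).continuousOn.congr fun y hy => ?_
  exact (if_pos hy).symm

lemma lt_phi (hQ : QConditions Q M ξ φ) {σ : ℝ} (h0 : 0 < σ) (h1 : σ < 1) : σ < φ σ := by
  have hge : ∀ s ∈ Icc (0 : ℝ) 1, s ≤ φ s := by
    intro s hs
    have := hQ.phi_concave.chord_le (x := 0) (y := 1) (by simp) (by simp) hs.1 hs.2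
    simpa [hQ.phi_zero, hQ.phi_one] using this
  obtain ⟨s, hs, hne⟩ := hQ.phi_ne_id
  have hlt : s < φ s := lt_of_le_of_ne (hge s hs) (Ne.symm hne)
  have hs0 : 0 < s := lt_of_le_of_ne hs.1 fun h => hne (by rw [← h, hQ.phi_zero])
  have hs1 : s < 1 := lt_of_le_of_ne hs.2 fun h => hne (by rw [h, hQ.phi_one])
  rcases le_total σ s with h | h
  · have := hQ.phi_concave.chord_le (x := 0) (y := s) (by simp) hs h0.le h
    rw [hQ.phi_zero] at this
    nlinarith
  · have := hQ.phi_concave.chord_le (x := s) (y := 1) hs (by simp) h h1.le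
    rw [hQ.phi_one] at this
    nlinarith

lemma one_add_mul_xi_pos (hQ : QConditions Q M ξ φ) (hM : 0 ≤ M) : 0 < (1 + M) * ξ :=
  mul_pos (by linarith) hQ.xi_pos

/-- If `φ σ` were `1`, then `inverse_ge` would contradict the strict monotonicity of the inverse
of `Q`. -/
lemma phi_lt_one (hQ : QConditions Q M ξ φ) (hM : 0 ≤ M) {σ : ℝ} (h0 : 0 < σ) (h1 : σ < 1) :
    φ σ < 1 := by
  refine lt_of_le_of_ne (hQ.phi_mapsTo ⟨h0.le, h1.le⟩).2 fun h => ?_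
  have hpos := hQ.one_add_mul_xi_pos hM
  have hu : (1 + M) * ξ / 2 ∈ Ioo 0 ((1 + M) * ξ) := ⟨by linarith, by linarith⟩
  have h2 := hQ.inverse_ge σ ⟨h0, h1⟩ _ hu
  have hσu : 0 ≤ σ * ((1 + M) * ξ / 2) := mul_nonneg h0.le hu.1.le
  rw [h, one_mul, hQ.le_inverse_iff hM (hQ.inverse_nonneg hM hu.1.le) hσu,
    hQ.apply_inverse hM hu.1.le] at h2
  nlinarith [hu.1]

/-- `Q(v) = o(v)` at the origin: iterating `inverse_ge` with `σ = 1/2` makes `Q(v) / v` decay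
geometrically along a sequence, because `φ(1/2) > 1/2`, and `Q(v) / v` is nondecreasing. -/
lemma exists_le_mul (hQ : QConditions Q M ξ φ) (hM : 0 ≤ M) {c : ℝ} (hc : 0 < c) :
    ∃ δ, 0 < δ ∧ ∀ v, 0 ≤ v → v ≤ δ → Q v ≤ c * v := by
  set p := φ (1 / 2)
  have hp : 1 / 2 < p := hQ.lt_phi (by norm_num) (by norm_num)
  set u := (1 + M) * ξ / 2
  have hpos := hQ.one_add_mul_xi_pos hM
  have hu : 0 < u := half_pos hpos
  have hun : ∀ n : ℕ, (1 / 2) ^ n * u ∈ Ioo 0 ((1 + M) * ξ) := fun n => by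
    refine ⟨by positivity, ?_⟩
    have : (1 / 2 : ℝ) ^ n ≤ 1 := pow_le_one₀ (by norm_num) (by norm_num)
    have : (1 / 2 : ℝ) ^ n * u ≤ u := mul_le_of_le_one_left hu.le this
    exact this.trans_lt (half_lt_self hpos)
  have hG : 0 < halfLineInverse Q u := by
    refine lt_of_le_of_ne (hQ.inverse_nonneg hM hu.le) fun h => ?_
    have := hQ.apply_inverse hM hu.le
    rw [← h, hQ.zero] at this
    exact hu.ne this
  have hiter : ∀ n : ℕ, p ^ n * halfLineInverse Q u ≤ halfLineInverse Q ((1 / 2) ^ n * u) := by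
    intro n
    induction n with
    | zero => simp
    | succ n ih =>
      have h := hQ.inverse_ge (1 / 2) ⟨by norm_num, by norm_num⟩ _ (hun n)
      rw [← mul_assoc, ← pow_succ'] at h
      refine le_trans ?_ h
      rw [pow_succ', mul_assoc]
      exact mul_le_mul_of_nonneg_left ih (by linarith)
  have hlim : Tendsto (fun n : ℕ => ((1 / 2) / p) ^ n * u) atTop (𝓝 0) := by
    have := (tendsto_pow_atTop_nhds_zero_of_lt_one (r := (1 / 2) / p) (by positivity)
      ((div_lt_one (by linarith)).2 hp)).mul_const u
    simpa using this
  obtain ⟨n, hn⟩ := (hlim.eventually_lt_const (mul_pos hc hG)).exists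
  have hpn : 0 < p ^ n := pow_pos (by linarith) n
  set d := halfLineInverse Q ((1 / 2) ^ n * u)
  have hd : 0 < d := (mul_pos hpn hG).trans_le (hiter n)
  have hQd : Q d ≤ c * d := by
    rw [hQ.apply_inverse hM (hun n).1.le]
    rw [div_pow, div_mul_eq_mul_div, div_lt_iff₀ hpn] at hn
    nlinarith [hiter n]
  refine ⟨d, hd, fun v hv hvd => ?_⟩
  have := hQ.mul_le_mul hv hvd hd
  nlinarith

/-- `Q(v) / v` is strictly increasing: equality would make `Q` linear near the origin. -/
lemma mul_lt_mul (hQ : QConditions Q M ξ φ) (hM : 0 ≤ M) {v w : ℝ} (hv : 0 < v) (hvw : v < w) :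
    Q v * w < Q w * v := by
  have hw : 0 < w := hv.trans hvw
  refine lt_of_le_of_ne (hQ.mul_le_mul hv.le hvw.le hw) fun heq => ?_
  have hQv : 0 < Q v := by
    rw [← hQ.zero]; exact hQ.strictMono self_mem_Ici hv.le hv
  obtain ⟨δ, hδ, hsmall⟩ := hQ.exists_le_mul hM (c := Q v / v / 2) (by positivity)
  set u := min δ (v / 2)
  have hu0 : 0 < u := lt_min hδ (by linarith)
  have huv : u < v := (min_le_right _ _).trans_lt (by linarith)
  have h1 := hsmall u hu0.le (min_le_left _ _)
  have h2 := hQ.convex.slope_mono_adjacent (x := u) (y := v) (z := w) hu0.le hw.le huv hvw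
  rw [div_le_div_iff₀ (by linarith) (by linarith)] at h2
  have h3 : Q v / v / 2 * u = Q v * u / (2 * v) := by field_simp
  rw [h3, le_div_iff₀ (by positivity)] at h1
  have h4 : Q v * u * (w - v) ≤ Q u * v * (w - v) := by nlinarith
  have h5 := le_of_mul_le_mul_right h4 (by linarith)
  nlinarith [mul_pos hQv hu0]

lemma exists_fixedPoint (hQ : QConditions Q M ξ φ) (hM : 0 ≤ M) :
    ∃ η, 0 < η ∧ η ≤ ξ ∧ Q η = η := by
  obtain ⟨δ, hδ, hsmall⟩ := hQ.exists_le_mul hM one_pos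
  have hξ := hQ.xi_pos
  set a := min δ ξ
  have ha : 0 < a := lt_min hδ hξ
  have haξ : a ≤ ξ := min_le_right _ _
  have hcont : ContinuousOn (fun v => Q v - v) (Icc a ξ) :=
    (hQ.cont.mono fun v hv => ha.le.trans hv.1).sub continuousOn_id
  have h1 := hsmall a ha.le (min_le_left _ _)
  have h2 := hQ.xi_eq
  obtain ⟨η, hη, h0⟩ := intermediate_value_Icc haξ hcont
    (show (0 : ℝ) ∈ _ from ⟨by linarith, by nlinarith⟩)
  exact ⟨η, ha.trans_le hη.1, hη.2, by simp only at h0; linarith⟩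

section FixedPoint

variable {η : ℝ}

lemma lt_self_of_lt (hQ : QConditions Q M ξ φ) (hM : 0 ≤ M) (hη : Q η = η) {v : ℝ} (hv : 0 < v)
    (hvη : v < η) : Q v < v := by
  have := hQ.mul_lt_mul hM hv hvη
  rw [hη, mul_comm η] at this
  exact lt_of_mul_lt_mul_right this (hv.trans hvη).le

lemma self_lt_of_lt (hQ : QConditions Q M ξ φ) (hM : 0 ≤ M) (hη0 : 0 < η) (hη : Q η = η) {v : ℝ}
    (hvη : η < v) : v < Q v := by
  have := hQ.mul_lt_mul hM hη0 hvη
  rw [hη, mul_comm η] at this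
  exact lt_of_mul_lt_mul_right this hη0.le

/-- The inverse of `Q` is a contraction towards the fixed point on every half-line that is bounded
away from the origin. -/
lemma exists_expansion (hQ : QConditions Q M ξ φ) (hM : 0 ≤ M) (hη0 : 0 < η) (hη : Q η = η) :
    ∃ q, 1 < q ∧ ∀ v, η / 2 ≤ v → q * |η - v| ≤ |η - Q v| := by
  have hlt := hQ.lt_self_of_lt hM hη (half_pos hη0) (half_lt_self hη0)
  refine ⟨(Q (η / 2) - Q η) / (η / 2 - η), ?_, fun v hv => ?_⟩
  · rw [lt_div_iff_of_neg (by linarith), hη]; linarith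
  · rcases eq_or_ne v η with rfl | hne
    · simp
    have h := hQ.convex.secant_mono (a := η) (x := η / 2) (y := v) hη0.le (half_pos hη0).le
      ((half_pos hη0).le.trans hv) (half_lt_self hη0).ne hne hv
    have h2 : |Q v - Q η| = |(Q v - Q η) / (v - η)| * |v - η| := by
      rw [abs_div, div_mul_cancel₀ _ (abs_pos.2 (sub_ne_zero.2 hne)).ne']
    rw [hη] at h h2
    rw [abs_sub_comm η v, abs_sub_comm η (Q v), hη, h2]
    exact mul_le_mul_of_nonneg_right (h.trans (le_abs_self _)) (abs_nonneg _)

end FixedPoint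

/-- A concave function lies above its chord from `r` to `1`. -/
lemma one_sub_le_phi (hQ : QConditions Q M ξ φ) {r s : ℝ} (hr0 : 0 ≤ r) (hr1 : r < 1)
    (hrs : r ≤ s) (hs : s ≤ 1) : 1 - (1 - φ r) / (1 - r) * (1 - s) ≤ φ s := by
  have hd : 0 < 1 - r := by linarith
  have := hQ.phi_concave.chord_le (x := r) (y := 1) ⟨hr0, hr1.le⟩ (by simp) hrs hs
  rw [hQ.phi_one] at this
  rw [div_mul_eq_mul_div, sub_le_iff_le_add, ← sub_le_iff_le_add', le_div_iff₀ hd]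
  linarith

end QConditions

/-! ### Asymptotics of solutions -/

/-- Nonlinearities `N(t, u)` that are monotone and continuous in `u` and lie between `u` and
`(1 + μ(t)) u`, where `μ` is non-negative and integrable. Those of the lower, the upper and the
main equation are all of this kind. -/
structure SandwichedNonlinearity (N : ℝ → ℝ → ℝ) (μ : ℝ → ℝ) : Prop where
  weight_nonneg : ∀ t, 0 < t → 0 ≤ μ t
  weight_integrable : IntegrableOn μ (Ioi 0)
  self_le : ∀ t, 0 < t → ∀ u, 0 ≤ u → u ≤ N t u
  le_mul : ∀ t, 0 < t → ∀ u, 0 ≤ u → N t u ≤ (1 + μ t) * u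
  mono : ∀ t, 0 < t → MonotoneOn (N t) (Ici 0)
  cont : ∀ t, 0 < t → ContinuousOn (N t) (Ici 0)
  meas : ∀ u : ℝ → ℝ, (∀ t, 0 ≤ t → 0 ≤ u t) → ContinuousOn u (Ici 0) →
    AEStronglyMeasurable (fun t => N t (u t)) (volume.restrict (Ioi 0))

/-- Non-negative, bounded and continuous functions on `[0, ∞)`. -/
structure IsProfile (u : ℝ → ℝ) : Prop where
  nonneg : ∀ x, 0 ≤ x → 0 ≤ u x
  bounded : ∃ c, ∀ x, 0 ≤ x → u x ≤ c
  cont : ContinuousOn u (Ici 0)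

lemma IsProfile.admissible {u : ℝ → ℝ} (hu : IsProfile u) : Admissible u := by
  obtain ⟨c, hc⟩ := hu.bounded
  refine .of_bounded (c := c)
    ((hu.cont.mono Ioi_subset_Ici_self).aestronglyMeasurable measurableSet_Ioi) fun t ht => ?_
  rw [abs_of_nonneg (hu.nonneg t ht.le)]
  exact hc t ht.le

lemma IsProfile.const {c : ℝ} (hc : 0 ≤ c) : IsProfile fun _ => c :=
  ⟨fun _ _ => hc, ⟨c, fun _ _ => le_rfl⟩, continuousOn_const⟩

lemma IsNontrivialSolution.isProfile {K Q u : ℝ → ℝ} {N : ℝ → ℝ → ℝ}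
    (hu : IsNontrivialSolution K Q N u) : IsProfile u := ⟨hu.nonneg, hu.bounded, hu.cont⟩

lemma IsStep.eq_kernelOp {K Q u v : ℝ → ℝ} {N : ℝ → ℝ → ℝ} (h : IsStep K Q N u v) {x : ℝ}
    (hx : 0 ≤ x) : Q (v x) = kernelOp K (fun t => N t (u t)) x := (h x hx).2

namespace SandwichedNonlinearity

variable {N : ℝ → ℝ → ℝ} {μ u : ℝ → ℝ}

lemma nonneg (hN : SandwichedNonlinearity N μ) (hu : ∀ x, 0 ≤ x → 0 ≤ u x) {t : ℝ} (ht : 0 < t) :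
    0 ≤ N t (u t) := (hu t ht.le).trans (hN.self_le t ht _ (hu t ht.le))

lemma le_add_mul (hN : SandwichedNonlinearity N μ) {c t v : ℝ} (ht : 0 < t) (hv : 0 ≤ v)
    (hvc : v ≤ c) : N t v ≤ v + c * μ t := by
  have := hN.le_mul t ht v hv
  nlinarith [hN.weight_nonneg t ht]

lemma admissible_of_meas (hN : SandwichedNonlinearity N μ)
    (hm : AEStronglyMeasurable (fun t => N t (u t)) (volume.restrict (Ioi 0)))
    (hu : ∀ x, 0 ≤ x → 0 ≤ u x) {c : ℝ} (hc : ∀ x, 0 ≤ x → u x ≤ c) :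
    Admissible fun t => N t (u t) := by
  refine ((Admissible.const c).add
    (.of_integrableOn (hN.weight_integrable.const_mul c))).mono' hm fun t ht => ?_
  rw [abs_of_nonneg (hN.nonneg hu ht)]
  have h1 := hN.le_add_mul ht (hu t ht.le) (hc t ht.le)
  have h2 := hc t ht.le
  exact le_trans (by linarith) (le_abs_self _)

lemma admissible (hN : SandwichedNonlinearity N μ) (hu : IsProfile u) :
    Admissible fun t => N t (u t) := by
  obtain ⟨c, hc⟩ := hu.bounded
  exact hN.admissible_of_meas (hN.meas u hu.nonneg hu.cont) hu.nonneg hc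

end SandwichedNonlinearity

namespace KernelConditions

variable {K h μ u : ℝ → ℝ} {N : ℝ → ℝ → ℝ}

/-- A lower bound on a unit interval away from the origin propagates to the adjacent interval. -/
lemma mul_le_kernelOp (hK : KernelConditions K) (hh : Admissible h) (hh0 : ∀ t, 0 < t → 0 ≤ h t)
    {a x ε : ℝ} (ha : 2 ≤ a) (hax : a ≤ x) (hxa : x ≤ a + 2) (hε : 0 ≤ ε)
    (hle : ∀ t ∈ Icc a (a + 1), ε ≤ h t) : (K 2 - K 4) * ε ≤ kernelOp K h x := by
  have hs : Icc a (a + 1) ⊆ Ioi 0 := fun t ht => lt_of_lt_of_le (by linarith) ht.1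
  calc (K 2 - K 4) * ε = ∫ _ in Icc a (a + 1), (K 2 - K 4) * ε := by simp
    _ ≤ ∫ t in Icc a (a + 1), diffKernel K x t * h t := by
      refine setIntegral_mono_on continuous_const.integrableOn_Icc
        ((hK.integrableOn_mul hh x).mono_set hs) measurableSet_Icc fun t ht => ?_
      have h1 : K 2 - K 4 ≤ diffKernel K x t := by
        apply hK.le_diffKernel
        · rw [abs_le]; constructor <;> linarith [ht.1, ht.2]
        · linarith [ht.1]
      exact mul_le_mul h1 (hle t ht) hε
        (hK.diffKernel_nonneg (by linarith) (by linarith [ht.1]))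
    _ ≤ _ := setIntegral_mono_set (hK.integrableOn_mul hh x)
      (ae_Ioi_of_forall fun t ht =>
        mul_nonneg (hK.diffKernel_nonneg (by linarith) ht.le) (hh0 t ht)) hs.eventuallyLE

lemma two_sub_four_pos (hK : KernelConditions K) : 0 < K 2 - K 4 :=
  sub_pos.2 (hK.lt_of_abs_lt (by norm_num))

lemma kernelOp_le_kernelOp_sandwiched (hK : KernelConditions K) (hN : SandwichedNonlinearity N μ)
    (hu : IsProfile u) {x : ℝ} (hx : 0 ≤ x) :
    kernelOp K u x ≤ kernelOp K (fun t => N t (u t)) x :=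
  hK.kernelOp_mono hu.admissible (hN.admissible hu)
    (fun t ht => hN.self_le t ht _ (hu.nonneg t ht.le)) hx

lemma kernelOp_sandwiched_le (hK : KernelConditions K) (hN : SandwichedNonlinearity N μ)
    (hu : IsProfile u) {c : ℝ} (hc : ∀ x, 0 ≤ x → u x ≤ c) {x : ℝ} (hx : 0 ≤ x) :
    kernelOp K (fun t => N t (u t)) x ≤ kernelOp K u x + kernelOp K (fun t => c * μ t) x := by
  have hμ : Admissible fun t => c * μ t := .of_integrableOn (hN.weight_integrable.const_mul c)
  rw [← hK.kernelOp_add hu.admissible hμ]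
  exact hK.kernelOp_mono (hN.admissible hu) (hu.admissible.add hμ)
    (fun t ht => hN.le_add_mul ht (hu.nonneg t ht.le) (hc t ht.le)) hx

/-- The inequality that makes the constant functions supersolutions. -/
lemma kernelOp_sandwiched_le_mul (hK : KernelConditions K) (hN : SandwichedNonlinearity N μ)
    (hu : IsProfile u) {c : ℝ} (hc : ∀ x, 0 ≤ x → u x ≤ c) {x : ℝ} (hx : 0 ≤ x) :
    kernelOp K (fun t => N t (u t)) x
      ≤ (1 + K 0 * ∫ t in Ioi 0, μ t) * c - 2 * c * kernelTail K x := by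
  have hc0 : 0 ≤ c := (hu.nonneg 0 le_rfl).trans (hc 0 le_rfl)
  have h1 := hK.kernelOp_sandwiched_le hN hu hc hx
  have h2 : kernelOp K u x ≤ kernelOp K (fun _ => c) x :=
    hK.kernelOp_mono hu.admissible (.const c) (fun t ht => hc t ht.le) hx
  have h3 := hK.kernelOp_le_integral hN.weight_integrable hN.weight_nonneg x
  rw [hK.kernelOp_const] at h2
  rw [kernelOp_const_mul] at h1
  have h4 := mul_le_mul_of_nonneg_left h3 hc0
  linarith

end KernelConditions

namespace IsNontrivialSolution

variable {K Q φ μ u : ℝ → ℝ} {N : ℝ → ℝ → ℝ} {M ξ η : ℝ}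

lemma apply_zero (hu : IsNontrivialSolution K Q N u) (hK : KernelConditions K)
    (hQ : QConditions Q M ξ φ) : u 0 = 0 := by
  refine hQ.strictMono.injOn (hu.nonneg 0 le_rfl) self_mem_Ici ?_
  rw [hu.eqn.eq_kernelOp le_rfl, hK.kernelOp_zero, hQ.zero]

lemma pos (hu : IsNontrivialSolution K Q N u) (hK : KernelConditions K)
    (hQ : QConditions Q M ξ φ) (hN : SandwichedNonlinearity N μ) {x : ℝ} (hx : 0 < x) :
    0 < u x := by
  refine lt_of_le_of_ne (hu.nonneg x hx.le) fun h0 => ?_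
  have h1 : kernelOp K (fun t => N t (u t)) x = 0 := by
    rw [← hu.eqn.eq_kernelOp hx.le, ← h0, hQ.zero]
  have h2 := hK.ae_eq_zero_of_kernelOp_eq_zero (hN.admissible hu.isProfile)
    (fun t ht => hN.nonneg hu.nonneg ht) hx h1
  have h3 : u =ᵐ[volume.restrict (Ioi 0)] fun _ => 0 := by
    filter_upwards [h2, ae_restrict_mem measurableSet_Ioi] with t ht ht0
    have ht0' : 0 ≤ t := le_of_lt ht0
    exact le_antisymm ((hN.self_le t ht0 _ (hu.nonneg t ht0')).trans ht.le) (hu.nonneg t ht0')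
  have h4 : EqOn u (fun _ => 0) (Ioi 0) :=
    Measure.eqOn_open_of_ae_eq h3 isOpen_Ioi (hu.cont.mono Ioi_subset_Ici_self) continuousOn_const
  obtain ⟨y, hy, hne⟩ := hu.nontrivial
  rcases hy.eq_or_lt with rfl | hy
  · exact hne (hu.apply_zero hK hQ)
  · exact hne (h4 hy)

lemma exists_pos_le (hu : IsNontrivialSolution K Q N u) (hK : KernelConditions K)
    (hQ : QConditions Q M ξ φ) (hM : 0 ≤ M) (hN : SandwichedNonlinearity N μ) :
    ∃ ε, 0 < ε ∧ ∀ x, 2 ≤ x → ε ≤ u x := by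
  obtain ⟨δ, hδ, hsmall⟩ := hQ.exists_le_mul hM hK.two_sub_four_pos
  obtain ⟨y, hy, hymin⟩ := isCompact_Icc.exists_isMinOn (nonempty_Icc.2 (by norm_num : (2 : ℝ) ≤ 3))
    (hu.cont.mono fun t ht => le_trans (by norm_num : (0 : ℝ) ≤ 2) ht.1)
  have hy0 : 0 < u y := hu.pos hK hQ hN (by linarith [hy.1])
  set ε := min δ (u y)
  have hε : 0 < ε := lt_min hδ hy0
  refine ⟨ε, hε, ?_⟩
  have hind : ∀ n : ℕ, ∀ x : ℝ, 2 ≤ x → x ≤ n + 3 → ε ≤ u x := by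
    intro n
    induction n with
    | zero =>
      intro x h2 h3
      have h3' : x ≤ 3 := by simpa using h3
      exact (min_le_right _ _).trans (hymin ⟨h2, h3'⟩)
    | succ n ih =>
      intro x h2 h3
      push_cast at h3
      rcases le_total x (n + 3) with h | h
      · exact ih x h2 h
      have hn : (0 : ℝ) ≤ n := n.cast_nonneg
      have h1 := hK.mul_le_kernelOp hu.isProfile.admissible (fun t ht => hu.nonneg t ht.le)
        (a := n + 2) (x := x) (by linarith) (by linarith) (by linarith) hε.le
        fun t ht => ih t (by linarith [ht.1]) (by linarith [ht.2])
      have h4 := hK.kernelOp_le_kernelOp_sandwiched hN hu.isProfile (x := x) (by linarith)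
      rw [← hu.eqn.eq_kernelOp (by linarith)] at h4
      rw [← hQ.strictMono.le_iff_le hε.le (hu.nonneg x (by linarith))]
      exact (hsmall ε hε.le (min_le_left _ _)).trans (h1.trans h4)
  intro x hx
  obtain ⟨n, hn⟩ := exists_nat_ge x
  exact hind n x hx (by linarith)

/-- The supremum of the eventual lower bounds not exceeding `η` is improved by one application of
the equation, unless it is `η` itself. -/
lemma eventually_ge (hu : IsNontrivialSolution K Q N u) (hK : KernelConditions K)
    (hQ : QConditions Q M ξ φ) (hM : 0 ≤ M) (hN : SandwichedNonlinearity N μ)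
    (hη0 : 0 < η) (hη : Q η = η) {a : ℝ} (ha : a < η) : ∀ᶠ x in atTop, a ≤ u x := by
  set S := {b | b ≤ η ∧ ∀ᶠ x in atTop, b ≤ u x}
  obtain ⟨ε, hε, hεu⟩ := hu.exists_pos_le hK hQ hM hN
  have hεS : min ε η ∈ S := ⟨min_le_right _ _, by
    filter_upwards [eventually_ge_atTop 2] with x hx using (min_le_left _ _).trans (hεu x hx)⟩
  have hbdd : BddAbove S := ⟨η, fun b hb => hb.1⟩
  set l := sSup S
  have hl0 : 0 < l := (lt_min hε hη0).trans_le (le_csSup hbdd hεS)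
  have hlη : η ≤ l := by
    by_contra! hlt
    have hQl := hQ.lt_self_of_lt hM hη hl0 hlt
    have hQl0 := hQ.nonneg hl0.le
    set y := (l + Q l) / 2
    have hy0 : 0 ≤ y := by simp only [y]; linarith
    set v := halfLineInverse Q y
    have hv0 : 0 ≤ v := hQ.inverse_nonneg hM hy0
    have hQv : Q v = y := hQ.apply_inverse hM hy0
    have hvl : l < v := by
      rw [← hQ.strictMono.lt_iff_lt hl0.le hv0, hQv]; simp only [y]; linarith
    have hvη : v ≤ η := by
      rw [← hQ.strictMono.le_iff_le hv0 hη0.le, hQv, hη]; simp only [y]; linarith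
    obtain ⟨b, hb, hlb⟩ := exists_lt_of_lt_csSup ⟨_, hεS⟩
      (show l - (l - Q l) / 4 < sSup S by simp only [l] at *; linarith)
    have hvS : v ∈ S := by
      refine ⟨hvη, ?_⟩
      filter_upwards [hK.eventually_le_kernelOp hu.isProfile.admissible
        (show 0 < (l - Q l) / 4 by linarith) hb.2, eventually_ge_atTop 0] with x hx hx0
      rw [← hQ.strictMono.le_iff_le hv0 (hu.nonneg x hx0), hQv, hu.eqn.eq_kernelOp hx0]
      have := hK.kernelOp_le_kernelOp_sandwiched hN hu.isProfile hx0
      simp only [y]; linarith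
    exact absurd (le_csSup hbdd hvS) (not_le_of_gt hvl)
  obtain ⟨b, hb, hab⟩ := exists_lt_of_lt_csSup ⟨_, hεS⟩ (ha.trans_le hlη)
  filter_upwards [hb.2] with x hx using hab.le.trans hx

lemma eventually_le (hu : IsNontrivialSolution K Q N u) (hK : KernelConditions K)
    (hQ : QConditions Q M ξ φ) (hM : 0 ≤ M) (hN : SandwichedNonlinearity N μ)
    (hη0 : 0 < η) (hη : Q η = η) {a : ℝ} (ha : η < a) : ∀ᶠ x in atTop, u x ≤ a := by
  set S := {b | η ≤ b ∧ ∀ᶠ x in atTop, u x ≤ b}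
  obtain ⟨c, hc⟩ := hu.bounded
  have hcS : max c η ∈ S := ⟨le_max_right _ _, by
    filter_upwards [eventually_ge_atTop 0] with x hx using (hc x hx).trans (le_max_left _ _)⟩
  have hbdd : BddBelow S := ⟨η, fun b hb => hb.1⟩
  set l := sInf S
  have hηl : η ≤ l := le_csInf ⟨_, hcS⟩ fun b hb => hb.1
  have hlη : l ≤ η := by
    by_contra! hlt
    have hQl := hQ.self_lt_of_lt hM hη0 hη hlt
    set y := (l + Q l) / 2
    have hl0 : 0 < l := hη0.trans hlt
    have hy0 : 0 ≤ y := by simp only [y]; linarith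
    set v := halfLineInverse Q y
    have hv0 : 0 ≤ v := hQ.inverse_nonneg hM hy0
    have hQv : Q v = y := hQ.apply_inverse hM hy0
    have hvl : v < l := by
      rw [← hQ.strictMono.lt_iff_lt hv0 hl0.le, hQv]; simp only [y]; linarith
    have hvη : η ≤ v := by
      rw [← hQ.strictMono.le_iff_le hη0.le hv0, hQv, hη]; simp only [y]; linarith
    have hδ : 0 < (Q l - l) / 6 := by linarith
    obtain ⟨b, hb, hlb⟩ := exists_lt_of_csInf_lt ⟨_, hcS⟩
      (show sInf S < l + (Q l - l) / 6 by simp only [l] at *; linarith)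
    have hvS : v ∈ S := by
      refine ⟨hvη, ?_⟩
      filter_upwards [hK.eventually_kernelOp_le hu.isProfile.admissible (hη0.le.trans hb.1) hδ hb.2,
        (hK.tendsto_kernelOp_zero (hN.weight_integrable.const_mul c)).eventually_lt_const hδ,
        eventually_ge_atTop 0] with x hx hx' hx0
      rw [← hQ.strictMono.le_iff_le (hu.nonneg x hx0) hv0, hQv, hu.eqn.eq_kernelOp hx0]
      have := hK.kernelOp_sandwiched_le hN hu.isProfile hc hx0
      simp only [y]; linarith
    exact absurd (csInf_le hbdd hvS) (not_le_of_gt hvl)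
  obtain ⟨b, hb, hab⟩ := exists_lt_of_csInf_lt ⟨_, hcS⟩ (hlη.trans_lt ha)
  filter_upwards [hb.2] with x hx using hx.trans hab.le

lemma tendsto (hu : IsNontrivialSolution K Q N u) (hK : KernelConditions K)
    (hQ : QConditions Q M ξ φ) (hM : 0 ≤ M) (hN : SandwichedNonlinearity N μ)
    (hη0 : 0 < η) (hη : Q η = η) : Tendsto u atTop (𝓝 η) := by
  refine tendsto_order.2 ⟨fun a ha => ?_, fun a ha => ?_⟩
  · obtain ⟨b, hab, hb⟩ := exists_between ha
    filter_upwards [hu.eventually_ge hK hQ hM hN hη0 hη hb] with x hx using hab.trans_le hx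
  · obtain ⟨b, hb, hba⟩ := exists_between ha
    filter_upwards [hu.eventually_le hK hQ hM hN hη0 hη hb] with x hx using hx.trans_lt hba

lemma integrableOn_sub (hu : IsNontrivialSolution K Q N u) (hK : KernelConditions K)
    (hQ : QConditions Q M ξ φ) (hM : 0 ≤ M) (hN : SandwichedNonlinearity N μ)
    (hη0 : 0 < η) (hη : Q η = η) : IntegrableOn (fun x => η - u x) (Ioi 0) := by
  obtain ⟨q, hq, hexp⟩ := hQ.exists_expansion hM hη0 hη
  obtain ⟨c, hc⟩ := hu.bounded
  obtain ⟨R, hR⟩ := eventually_atTop.1 (hu.eventually_ge hK hQ hM hN hη0 hη (half_lt_self hη0))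
  have hadm := hu.isProfile.admissible
  have hd : Admissible fun x => η - u x := (Admissible.const η).sub hadm
  have hcμ : IntegrableOn (fun t => c * μ t) (Ioi 0) := hN.weight_integrable.const_mul c
  have hg : IntegrableOn (fun x => 2 * η * kernelTail K x + kernelOp K (fun t => c * μ t) x)
      (Ioi 0) := (hK.integrableOn_kernelTail.const_mul _).add (hK.integrableOn_kernelOp hcμ)
  refine (integrable_norm_iff hd.meas).1 ?_
  refine hK.integrableOn_of_le_kernelOp (c := η + c) (R := max R 0) hd.meas.norm
    (fun t _ => norm_nonneg _) (fun t ht => ?_) hq (le_max_right _ _) hg fun x hx => ?_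
  · rw [Real.norm_eq_abs, abs_le]
    constructor <;> linarith [hc t ht.le, hu.nonneg t ht.le]
  · have hx0 : 0 ≤ x := (le_max_right _ _).trans hx
    refine (hexp (u x) (hR x ((le_max_left _ _).trans hx))).trans ?_
    have h1 := hK.kernelOp_le_kernelOp_sandwiched hN hu.isProfile hx0
    have h2 := hK.kernelOp_sandwiched_le hN hu.isProfile hc hx0
    have h3 := hK.abs_kernelOp_le (h := fun t => η - u t) hx0
    rw [← hu.eqn.eq_kernelOp hx0] at h1 h2
    rw [hK.kernelOp_sub (.const η) hadm, hK.kernelOp_const] at h3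
    have h4 := hK.kernelTail_nonneg x
    have h5 := abs_le.1 h3
    simp only [Real.norm_eq_abs]
    rw [abs_le]
    constructor <;> nlinarith

/-- The supremum `S` of a solution satisfies `Q(S) ≤ (1 + K(0) ∫ μ) S`. -/
lemma le_of_eq_mul (hu : IsNontrivialSolution K Q N u) (hK : KernelConditions K)
    (hQ : QConditions Q M ξ φ) (hM : 0 ≤ M) (hN : SandwichedNonlinearity N μ)
    {β : ℝ} (hβ0 : 0 < β) (hβ : Q β = (1 + K 0 * ∫ t in Ioi 0, μ t) * β) :
    ∀ x, 0 ≤ x → u x ≤ β := by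
  set m := 1 + K 0 * ∫ t in Ioi 0, μ t
  have hm : 0 ≤ m := by
    have : 0 ≤ ∫ t in Ioi 0, μ t := setIntegral_nonneg measurableSet_Ioi hN.weight_nonneg
    have := hK.pos 0
    positivity
  obtain ⟨c, hc⟩ := hu.bounded
  have hbdd : BddAbove (u '' Ici 0) := ⟨c, by rintro _ ⟨x, hx, rfl⟩; exact hc x hx⟩
  set S := sSup (u '' Ici 0)
  have hS : ∀ x, 0 ≤ x → u x ≤ S := fun x hx => le_csSup hbdd ⟨x, hx, rfl⟩
  have hS0 : 0 ≤ S := (hu.nonneg 0 le_rfl).trans (hS 0 le_rfl)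
  have hSβ : S ≤ β := by
    by_contra! hlt
    have h1 : Q S ≤ m * S := by
      have hmS : 0 ≤ m * S := mul_nonneg hm hS0
      rw [← hQ.le_inverse_iff hM hS0 hmS]
      refine csSup_le ⟨_, 0, self_mem_Ici, rfl⟩ ?_
      rintro _ ⟨x, hx, rfl⟩
      rw [hQ.le_inverse_iff hM (hu.nonneg x hx) hmS, hu.eqn.eq_kernelOp hx]
      have h2 := hK.kernelOp_sandwiched_le_mul hN hu.isProfile hS hx
      have h3 := mul_nonneg hS0 (hK.kernelTail_nonneg x)
      linarith
    have h4 := hQ.mul_lt_mul hM hβ0 hlt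
    rw [hβ] at h4
    nlinarith
  exact fun x hx => (hS x hx).trans hSβ

end IsNontrivialSolution

/-! ### Uniqueness for the linear weights -/

namespace KernelConditions

variable {K g m : ℝ → ℝ}

lemma integrableOn_mul_kernelOp (hK : KernelConditions K) (hm : Admissible m)
    (hm0 : ∀ t, 0 < t → 0 ≤ m t) (hg : IntegrableOn g (Ioi 0)) :
    IntegrableOn (fun x => m x * kernelOp K g x) (Ioi 0) := by
  have h := (hK.integrable_prod hm hm0 hg).integral_prod_left
  refine h.congr (Eventually.of_forall fun x => ?_)
  simp only [kernelOp, ← integral_const_mul]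
  congr 1 with t; ring

lemma integrableOn_kernelOp_mul (hK : KernelConditions K) (hm : Admissible m)
    (hm0 : ∀ t, 0 < t → 0 ≤ m t) (hg : IntegrableOn g (Ioi 0)) :
    IntegrableOn (fun t => kernelOp K m t * g t) (Ioi 0) := by
  have h := (hK.integrable_prod hm hm0 hg).integral_prod_right
  refine h.congr (Eventually.of_forall fun t => ?_)
  simp only [kernelOp, ← integral_mul_const, hK.diffKernel_comm t]

lemma integral_mul_kernelOp_comm (hK : KernelConditions K) (hm : Admissible m)
    (hm0 : ∀ t, 0 < t → 0 ≤ m t) (hg : IntegrableOn g (Ioi 0)) :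
    ∫ x in Ioi 0, m x * kernelOp K g x = ∫ t in Ioi 0, kernelOp K m t * g t := by
  have h := integral_integral_swap (f := fun x t => diffKernel K x t * m x * g t)
    (hK.integrable_prod hm hm0 hg)
  have e1 : ∀ x, m x * kernelOp K g x = ∫ t in Ioi 0, diffKernel K x t * m x * g t := fun x => by
    rw [kernelOp, ← integral_const_mul]
    congr 1 with t; ring
  have e2 : ∀ t, kernelOp K m t * g t = ∫ x in Ioi 0, diffKernel K x t * m x * g t := fun t => by
    simp only [kernelOp, ← integral_mul_const, hK.diffKernel_comm t]
  simp only [e1, e2]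
  exact h

end KernelConditions

section Nonlinearities

variable {μ : ℝ → ℝ}

lemma lowerNonlinearity_eq : lowerNonlinearity = upperNonlinearity fun _ => 0 := by
  ext t u
  simp [lowerNonlinearity, upperNonlinearity]

lemma sandwiched_upper (hμ0 : ∀ t, 0 < t → 0 ≤ μ t) (hμ : IntegrableOn μ (Ioi 0)) :
    SandwichedNonlinearity (upperNonlinearity μ) μ where
  weight_nonneg := hμ0
  weight_integrable := hμ
  self_le t ht u hu := by
    have := mul_nonneg (hμ0 t ht) hu
    simp only [upperNonlinearity]; linarith
  le_mul t _ u _ := le_rfl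
  mono t ht u _ v _ huv := mul_le_mul_of_nonneg_left huv (by linarith [hμ0 t ht])
  cont t _ := continuousOn_const.mul continuousOn_id
  meas u _ hc := (aestronglyMeasurable_const.add hμ.1).mul
    ((hc.mono Ioi_subset_Ici_self).aestronglyMeasurable measurableSet_Ioi)

lemma sandwiched_lower : SandwichedNonlinearity lowerNonlinearity fun _ => 0 := by
  rw [lowerNonlinearity_eq]
  exact sandwiched_upper (fun _ _ => le_rfl) integrableOn_zero

end Nonlinearities

/-- The operator is symmetric, so two ordered solutions `u ≤ v` of a linearly weighted equation
satisfy `∫ (1 + μ) (u Q(v) - v Q(u)) = 0`, in which the integrand is non-negative because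
`Q(s) / s` is increasing. Integrability of `v - u` is what makes the integrals converge. -/
lemma IsNontrivialSolution.eqOn_of_le {K Q φ μ u v : ℝ → ℝ} {M ξ : ℝ}
    (hu : IsNontrivialSolution K Q (upperNonlinearity μ) u)
    (hv : IsNontrivialSolution K Q (upperNonlinearity μ) v) (hK : KernelConditions K)
    (hQ : QConditions Q M ξ φ) (hM : 0 ≤ M) (hμ0 : ∀ t, 0 < t → 0 ≤ μ t)
    (hμ : IntegrableOn μ (Ioi 0)) (huv : ∀ x, 0 ≤ x → u x ≤ v x) : EqOn u v (Ici 0) := by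
  have hN := sandwiched_upper hμ0 hμ
  obtain ⟨η, hη0, -, hη⟩ := hQ.exists_fixedPoint hM
  have hd : IntegrableOn (fun x => v x - u x) (Ioi 0) := by
    refine ((hu.integrableOn_sub hK hQ hM hN hη0 hη).sub
      (hv.integrableOn_sub hK hQ hM hN hη0 hη)).congr (Eventually.of_forall fun x => ?_)
    simp
  obtain ⟨c, hc⟩ := hv.bounded
  have hg : IntegrableOn (fun x => (1 + μ x) * (v x - u x)) (Ioi 0) := by
    refine Integrable.mono' (g := fun x => (v x - u x) + c * μ x) (hd.add (hμ.const_mul c))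
      ((aestronglyMeasurable_const.add hμ.1).mul hd.1) (ae_Ioi_of_forall fun t ht => ?_)
    have h1 := huv t ht.le
    have h2 := hμ0 t ht
    have h3 := hc t ht.le
    have h4 := hu.nonneg t ht.le
    rw [Real.norm_of_nonneg (mul_nonneg (by linarith) (by linarith))]
    nlinarith
  have hau := hN.admissible hu.isProfile
  have hav := hN.admissible hv.isProfile
  have hau0 : ∀ t, 0 < t → 0 ≤ upperNonlinearity μ t (u t) := fun t ht => hN.nonneg hu.nonneg ht
  have hTd : ∀ x, 0 ≤ x → kernelOp K (fun x => (1 + μ x) * (v x - u x)) x = Q (v x) - Q (u x) := by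
    intro x hx
    rw [hv.eqn.eq_kernelOp hx, hu.eqn.eq_kernelOp hx, ← hK.kernelOp_sub hav hau]
    simp only [upperNonlinearity, mul_sub]
  have hsymm := hK.integral_mul_kernelOp_comm hau hau0 hg
  have hi1 := hK.integrableOn_mul_kernelOp hau hau0 hg
  have hi2 := hK.integrableOn_kernelOp_mul hau hau0 hg
  have hform : ∀ t, 0 < t → upperNonlinearity μ t (u t)
      * kernelOp K (fun x => (1 + μ x) * (v x - u x)) t
      - kernelOp K (fun t => upperNonlinearity μ t (u t)) t * ((1 + μ t) * (v t - u t))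
      = (1 + μ t) * (Q (v t) * u t - Q (u t) * v t) := by
    intro t ht
    rw [hTd t ht.le, ← hu.eqn.eq_kernelOp ht.le, upperNonlinearity]
    ring
  have hint : IntegrableOn (fun t => (1 + μ t) * (Q (v t) * u t - Q (u t) * v t)) (Ioi 0) :=
    IntegrableOn.congr_fun (hi1.sub hi2) hform measurableSet_Ioi
  have hsub : ∫ t in Ioi 0, (1 + μ t) * (Q (v t) * u t - Q (u t) * v t) = 0 := by
    rw [← setIntegral_congr_fun measurableSet_Ioi hform, integral_sub hi1 hi2, hsymm, sub_self]
  have hnn := (integral_eq_zero_iff_of_nonneg_ae (ae_Ioi_of_forall fun t ht =>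
    mul_nonneg (by linarith [hμ0 t ht]) (sub_nonneg.2
      (hQ.mul_le_mul (hu.nonneg t ht.le) (huv t ht.le) (hv.pos hK hQ hN ht)))) hint).1 hsub
  have hae : u =ᵐ[volume.restrict (Ioi 0)] v := by
    filter_upwards [hnn, ae_restrict_mem measurableSet_Ioi] with t ht ht0
    have h1 := (mul_eq_zero.1 ht).resolve_left (by linarith [hμ0 t ht0])
    by_contra hne
    have := hQ.mul_lt_mul hM (hu.pos hK hQ hN ht0)
      (lt_of_le_of_ne (huv t (le_of_lt ht0)) hne)
    linarith
  have heq : EqOn u v (Ioi 0) := Measure.eqOn_open_of_ae_eq hae isOpen_Ioi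
    (hu.cont.mono Ioi_subset_Ici_self) (hv.cont.mono Ioi_subset_Ici_self)
  intro x hx
  rcases (mem_Ici.1 hx).eq_or_lt with rfl | hx
  · rw [hu.apply_zero hK hQ, hv.apply_zero hK hQ]
  · exact heq hx

/-! ### Successive approximations -/

/-- One step `u ↦ Q⁻¹(∫₀^∞ (K(x - t) - K(x + t)) N(t, u(t)) dt)` of the successive
approximations. -/
noncomputable def approxStep (K Q : ℝ → ℝ) (N : ℝ → ℝ → ℝ) (u : ℝ → ℝ) (x : ℝ) : ℝ :=
  halfLineInverse Q (kernelOp K (fun t => N t (u t)) x)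

section Approximation

variable {K Q φ μ U u v : ℝ → ℝ} {N : ℝ → ℝ → ℝ} {M ξ : ℝ}

lemma kernelOp_sandwiched_nonneg (hK : KernelConditions K) (hN : SandwichedNonlinearity N μ)
    (hu : ∀ x, 0 ≤ x → 0 ≤ u x) {x : ℝ} (hx : 0 ≤ x) :
    0 ≤ kernelOp K (fun t => N t (u t)) x :=
  hK.kernelOp_nonneg (fun _ ht => hN.nonneg hu ht) hx

lemma IsProfile.approxStep (hu : IsProfile u) (hK : KernelConditions K)
    (hQ : QConditions Q M ξ φ) (hM : 0 ≤ M) (hN : SandwichedNonlinearity N μ) :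
    IsProfile (approxStep K Q N u) where
  nonneg x hx := hQ.inverse_nonneg hM (kernelOp_sandwiched_nonneg hK hN hu.nonneg hx)
  bounded := by
    obtain ⟨C, hC⟩ := hK.exists_kernelOp_le (hN.admissible hu)
    exact ⟨halfLineInverse Q C, fun x hx =>
      hQ.inverse_mono hM (kernelOp_sandwiched_nonneg hK hN hu.nonneg hx) (hC x hx)⟩
  cont := (hQ.continuousOn_inverse hM).comp
    (hK.continuous_kernelOp (hN.admissible hu)).continuousOn
    fun _ hx => kernelOp_sandwiched_nonneg hK hN hu.nonneg hx

lemma apply_approxStep (hK : KernelConditions K) (hQ : QConditions Q M ξ φ) (hM : 0 ≤ M)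
    (hN : SandwichedNonlinearity N μ) (hu : ∀ x, 0 ≤ x → 0 ≤ u x) {x : ℝ} (hx : 0 ≤ x) :
    Q (approxStep K Q N u x) = kernelOp K (fun t => N t (u t)) x :=
  hQ.apply_inverse hM (kernelOp_sandwiched_nonneg hK hN hu hx)

lemma isStep_approxStep (hK : KernelConditions K) (hQ : QConditions Q M ξ φ) (hM : 0 ≤ M)
    (hN : SandwichedNonlinearity N μ) (hu : IsProfile u) :
    IsStep K Q N u (approxStep K Q N u) := fun x hx =>
  ⟨hK.integrableOn_mul (hN.admissible hu) x, apply_approxStep hK hQ hM hN hu.nonneg hx⟩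

lemma kernelOp_sandwiched_mono (hK : KernelConditions K) (hN : SandwichedNonlinearity N μ)
    (hu : IsProfile u) (hv : IsProfile v) (huv : ∀ x, 0 ≤ x → u x ≤ v x) {x : ℝ} (hx : 0 ≤ x) :
    kernelOp K (fun t => N t (u t)) x ≤ kernelOp K (fun t => N t (v t)) x :=
  hK.kernelOp_mono (hN.admissible hu) (hN.admissible hv)
    (fun t ht => hN.mono t ht (hu.nonneg t ht.le) (hv.nonneg t ht.le) (huv t ht.le)) hx

lemma approxStep_mono (hK : KernelConditions K) (hQ : QConditions Q M ξ φ) (hM : 0 ≤ M)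
    (hN : SandwichedNonlinearity N μ) (hu : IsProfile u) (hv : IsProfile v)
    (huv : ∀ x, 0 ≤ x → u x ≤ v x) {x : ℝ} (hx : 0 ≤ x) :
    approxStep K Q N u x ≤ approxStep K Q N v x :=
  hQ.inverse_mono hM (kernelOp_sandwiched_nonneg hK hN hu.nonneg hx)
    (kernelOp_sandwiched_mono hK hN hu hv huv hx)

lemma le_approxStep (hK : KernelConditions K) (hQ : QConditions Q M ξ φ) (hM : 0 ≤ M)
    (hN : SandwichedNonlinearity N μ) (hu : IsProfile u) {x a : ℝ} (hx : 0 ≤ x) (ha : 0 ≤ a)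
    (h : Q a ≤ kernelOp K (fun t => N t (u t)) x) : a ≤ approxStep K Q N u x :=
  (hQ.le_inverse_iff hM ha (kernelOp_sandwiched_nonneg hK hN hu.nonneg hx)).2 h

lemma approxStep_le (hK : KernelConditions K) (hQ : QConditions Q M ξ φ) (hM : 0 ≤ M)
    (hN : SandwichedNonlinearity N μ) (hu : IsProfile u) {x a : ℝ} (hx : 0 ≤ x) (ha : 0 ≤ a)
    (h : kernelOp K (fun t => N t (u t)) x ≤ Q a) : approxStep K Q N u x ≤ a :=
  (hQ.inverse_le_iff hM ha (kernelOp_sandwiched_nonneg hK hN hu.nonneg hx)).2 h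

lemma IsProfile.iterate (hU : IsProfile U) (hK : KernelConditions K)
    (hQ : QConditions Q M ξ φ) (hM : 0 ≤ M) (hN : SandwichedNonlinearity N μ) (n : ℕ) :
    IsProfile ((_root_.approxStep K Q N)^[n] U) := by
  induction n with
  | zero => exact hU
  | succ n ih =>
    rw [Function.iterate_succ_apply']
    exact ih.approxStep hK hQ hM hN

lemma iterate_succ_le (hK : KernelConditions K) (hQ : QConditions Q M ξ φ) (hM : 0 ≤ M)
    (hN : SandwichedNonlinearity N μ) (hU : IsProfile U)
    (hsuper : ∀ x, 0 ≤ x → approxStep K Q N U x ≤ U x) (n : ℕ) :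
    ∀ x, 0 ≤ x → (approxStep K Q N)^[n + 1] U x ≤ (approxStep K Q N)^[n] U x := by
  induction n with
  | zero => simpa using hsuper
  | succ n ih =>
    intro x hx
    have hn := hU.iterate hK hQ hM hN n
    simp only [Function.iterate_succ_apply'] at ih ⊢
    exact approxStep_mono hK hQ hM hN (hn.approxStep hK hQ hM hN) hn ih hx

/-- A subsolution below the starting function stays below all approximations. -/
lemma le_iterate (hK : KernelConditions K) (hQ : QConditions Q M ξ φ) (hM : 0 ≤ M)
    (hN : SandwichedNonlinearity N μ) (hU : IsProfile U) (hv : IsProfile v)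
    (hsub : ∀ x, 0 ≤ x → Q (v x) ≤ kernelOp K (fun t => N t (v t)) x)
    (hvU : ∀ x, 0 ≤ x → v x ≤ U x) (n : ℕ) :
    ∀ x, 0 ≤ x → v x ≤ (approxStep K Q N)^[n] U x := by
  induction n with
  | zero => exact hvU
  | succ n ih =>
    intro x hx
    rw [Function.iterate_succ_apply']
    have hn := hU.iterate hK hQ hM hN n
    exact le_approxStep hK hQ hM hN hn hx (hv.nonneg x hx)
      ((hsub x hx).trans (kernelOp_sandwiched_mono hK hN hv hn ih hx))

/-- The approximations that start from a supersolution decrease to a solution. -/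
lemma exists_tendsto_iterate (hK : KernelConditions K) (hQ : QConditions Q M ξ φ) (hM : 0 ≤ M)
    (hN : SandwichedNonlinearity N μ) (hU : IsProfile U)
    (hsuper : ∀ x, 0 ≤ x → approxStep K Q N U x ≤ U x) :
    ∃ B, IsProfile B ∧ IsStep K Q N B B ∧
      ∀ x, 0 ≤ x → Tendsto (fun n => (approxStep K Q N)^[n] U x) atTop (𝓝 (B x)) := by
  set A : ℕ → ℝ → ℝ := fun n => (approxStep K Q N)^[n] U
  have hA : ∀ n, IsProfile (A n) := hU.iterate hK hQ hM hN
  have hanti : ∀ x, 0 ≤ x → Antitone fun n => A n x := fun x hx =>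
    antitone_nat_of_succ_le fun n => iterate_succ_le hK hQ hM hN hU hsuper n x hx
  set B : ℝ → ℝ := fun x => ⨅ n, A n x
  have hlim : ∀ x, 0 ≤ x → Tendsto (fun n => A n x) atTop (𝓝 (B x)) := fun x hx =>
    tendsto_atTop_ciInf (hanti x hx) ⟨0, by rintro _ ⟨n, rfl⟩; exact (hA n).nonneg x hx⟩
  have hB0 : ∀ x, 0 ≤ x → 0 ≤ B x := fun x hx =>
    ge_of_tendsto' (hlim x hx) fun n => (hA n).nonneg x hx
  obtain ⟨c, hc⟩ := hU.bounded
  have hAc : ∀ n x, 0 ≤ x → A n x ≤ c := fun n x hx =>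
    (hanti x hx (Nat.zero_le n)).trans (hc x hx)
  have hBc : ∀ x, 0 ≤ x → B x ≤ c := fun x hx => le_of_tendsto' (hlim x hx) fun n => hAc n x hx
  have hNlim : ∀ t, 0 < t → Tendsto (fun n => N t (A n t)) atTop (𝓝 (N t (B t))) := by
    intro t ht
    refine (hN.cont t ht (B t) (hB0 t ht.le)).tendsto.comp ?_
    exact tendsto_nhdsWithin_iff.2 ⟨hlim t ht.le,
      Eventually.of_forall fun n => (hA n).nonneg t ht.le⟩
  have hNB : Admissible fun t => N t (B t) :=
    hN.admissible_of_meas (aestronglyMeasurable_of_tendsto_ae atTop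
      (fun n => (hN.admissible (hA n)).meas) (ae_Ioi_of_forall hNlim)) hB0 hBc
  have hdom : Admissible fun t => c + c * μ t :=
    (Admissible.const c).add (.of_integrableOn (hN.weight_integrable.const_mul c))
  have hTlim : ∀ x, 0 ≤ x → Tendsto (fun n => kernelOp K (fun t => N t (A n t)) x) atTop
      (𝓝 (kernelOp K (fun t => N t (B t)) x)) := by
    intro x hx
    refine tendsto_integral_of_dominated_convergence
      (fun t => diffKernel K x t * (c + c * μ t))
      (fun n => (hK.integrableOn_mul (hN.admissible (hA n)) x).1) (hK.integrableOn_mul hdom x)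
      (fun n => ae_Ioi_of_forall fun t ht => ?_)
      (ae_Ioi_of_forall fun t ht => (hNlim t ht).const_mul _)
    have hk := hK.diffKernel_nonneg hx ht.le
    rw [Real.norm_of_nonneg (mul_nonneg hk (hN.nonneg (hA n).nonneg ht))]
    refine mul_le_mul_of_nonneg_left ?_ hk
    have h1 := hN.le_add_mul ht ((hA n).nonneg t ht.le) (hAc n t ht.le)
    have h2 := hAc n t ht.le
    linarith
  have hT0 : ∀ x, 0 ≤ x → 0 ≤ kernelOp K (fun t => N t (B t)) x := fun x hx =>
    kernelOp_sandwiched_nonneg hK hN hB0 hx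
  have hstep : ∀ x, 0 ≤ x → B x = approxStep K Q N B x := by
    intro x hx
    have h1 : Tendsto (fun n => A (n + 1) x) atTop (𝓝 (approxStep K Q N B x)) := by
      simp only [A, Function.iterate_succ_apply']
      refine ((hQ.continuousOn_inverse hM) _ (hT0 x hx)).tendsto.comp ?_
      exact tendsto_nhdsWithin_iff.2 ⟨hTlim x hx, Eventually.of_forall fun n =>
        kernelOp_sandwiched_nonneg hK hN (hA n).nonneg hx⟩
    exact tendsto_nhds_unique ((tendsto_add_atTop_iff_nat 1).2 (hlim x hx)) h1
  have hcont : ContinuousOn B (Ici 0) := by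
    refine ((hQ.continuousOn_inverse hM).comp (hK.continuous_kernelOp hNB).continuousOn
      fun x hx => hT0 x hx).congr fun x hx => hstep x hx
  refine ⟨B, ⟨hB0, ⟨c, hBc⟩, hcont⟩, fun x hx => ⟨hK.integrableOn_mul hNB x, ?_⟩, hlim⟩
  rw [hstep x hx]
  exact apply_approxStep hK hQ hM hN hB0 hx

/-- The approximations that start from the constant `β` with `Q(β) = (1 + K(0) ∫ μ) β` converge to
the largest solution. They stay above a positive constant on `[2, ∞)`, so it is nontrivial. -/
lemma exists_largest_solution (hK : KernelConditions K) (hQ : QConditions Q M ξ φ) (hM : 0 ≤ M)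
    (hN : SandwichedNonlinearity N μ) {β : ℝ} (hβ0 : 0 < β)
    (hβ : Q β = (1 + K 0 * ∫ t in Ioi 0, μ t) * β) :
    ∃ B, IsNontrivialSolution K Q N B ∧
      (∀ v, IsNontrivialSolution K Q N v → ∀ x, 0 ≤ x → v x ≤ B x) ∧
      ∀ x, 0 ≤ x → Tendsto (fun n => (approxStep K Q N)^[n] (fun _ => β) x) atTop (𝓝 (B x)) := by
  have hU : IsProfile fun _ : ℝ => β := .const hβ0.le
  have hsuper : ∀ x, 0 ≤ x → approxStep K Q N (fun _ => β) x ≤ β := fun x hx => by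
    refine approxStep_le hK hQ hM hN hU hx hβ0.le ?_
    have h1 := hK.kernelOp_sandwiched_le_mul hN hU (c := β) (fun _ _ => le_rfl) hx
    have h2 := mul_nonneg hβ0.le (hK.kernelTail_nonneg x)
    rw [hβ]; linarith
  obtain ⟨B, hB, hBstep, hlim⟩ := exists_tendsto_iterate hK hQ hM hN hU hsuper
  refine ⟨B, ⟨hB.nonneg, ?_, hB.bounded, hB.cont, hBstep⟩, fun v hv x hx => ?_, hlim⟩
  · obtain ⟨δ, hδ, hsmall⟩ := hQ.exists_le_mul hM hK.two_sub_four_pos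
    have hε : 0 < min δ β := lt_min hδ hβ0
    have hlow : ∀ n x, 2 ≤ x → min δ β ≤ (approxStep K Q N)^[n] (fun _ => β) x := by
      intro n
      induction n with
      | zero => exact fun x _ => min_le_right _ _
      | succ n ih =>
        intro x hx
        have hn := hU.iterate hK hQ hM hN n
        have hx0 : 0 ≤ x := by linarith
        rw [Function.iterate_succ_apply']
        refine le_approxStep hK hQ hM hN hn hx0 hε.le ?_
        refine (hsmall _ hε.le (min_le_left _ _)).trans (le_trans ?_
          (hK.kernelOp_le_kernelOp_sandwiched hN hn hx0))
        exact hK.mul_le_kernelOp hn.admissible (fun t ht => hn.nonneg t ht.le) hx le_rfl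
          (by linarith) hε.le fun t ht => ih t (hx.trans ht.1)
    refine ⟨2, zero_le_two, (hε.trans_le ?_).ne'⟩
    exact ge_of_tendsto' (hlim 2 zero_le_two) fun n => hlow n 2 le_rfl
  · exact ge_of_tendsto' (hlim x hx) fun n => le_iterate hK hQ hM hN hU hv.isProfile
      (fun x hx => (hv.eqn.eq_kernelOp hx).le) (hv.le_of_eq_mul hK hQ hM hN hβ0 hβ) n x hx

end Approximation

/-! ### The main nonlinearity -/

section MainNonlinearity

variable {ω : ℝ → ℝ → ℝ} {μ : ℝ → ℝ}

lemma OmegaConditions.nonneg (hω : OmegaConditions ω μ) {t u : ℝ} (ht : 0 ≤ t) (hu : 0 ≤ u) :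
    0 ≤ ω t u := by
  rw [← hω.zero t ht]
  exact hω.mono t ht self_mem_Ici hu hu

lemma OmegaConditions.sandwiched (hω : OmegaConditions ω μ) :
    SandwichedNonlinearity (mainNonlinearity ω) μ where
  weight_nonneg t ht := (hω.majorant_pos t ht.le).le
  weight_integrable := hω.majorant_integrable
  self_le t ht u hu := le_add_of_nonneg_right (hω.nonneg ht.le hu)
  le_mul t ht u hu := by
    have := hω.le_majorant t ht.le u hu
    simp only [mainNonlinearity]; linarith
  mono t ht u hu v hv huv := add_le_add huv (hω.mono t ht.le hu hv huv)
  cont t ht := by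
    refine continuousOn_id.add (hω.cont.comp (f := fun u => (t, u)) (by fun_prop) ?_)
    exact fun u hu => ⟨ht.le, hu⟩
  meas u hu hc := by
    have h1 : ContinuousOn (fun t => ω t (u t)) (Ici 0) :=
      hω.cont.comp (f := fun t => (t, u t)) (continuousOn_id.prodMk hc)
        fun t ht => ⟨ht, hu t ht⟩
    exact ((hc.add h1).mono Ioi_subset_Ici_self).aestronglyMeasurable measurableSet_Ioi

/-- Concavity together with `ω(t, 0) = 0`. -/
lemma OmegaConditions.mul_le_main (hω : OmegaConditions ω μ) {t u s : ℝ} (ht : 0 ≤ t) (hu : 0 ≤ u)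
    (hs0 : 0 ≤ s) (hs1 : s ≤ 1) :
    s * mainNonlinearity ω t u ≤ mainNonlinearity ω t (s * u) := by
  rcases hu.eq_or_lt with rfl | hu
  · simp [mainNonlinearity, hω.zero t ht]
  have h := (hω.concave t ht).chord_le (x := 0) (y := u) (z := s * u) self_mem_Ici hu.le
    (by positivity) (mul_le_of_le_one_left hu.le hs1)
  rw [hω.zero t ht] at h
  have h2 : (s * ω t u) * u ≤ ω t (s * u) * u := by linarith
  have h3 := le_of_mul_le_mul_right h2 hu
  simp only [mainNonlinearity]
  linarith

end MainNonlinearity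

/-! ### Comparison of the first two approximations -/

namespace KernelConditions

variable {K F g : ℝ → ℝ}

lemma exists_diffKernel_le (hK : KernelConditions K) :
    ∃ D, 0 ≤ D ∧ ∀ x t, 0 ≤ x → diffKernel K x t ≤ D * x := by
  obtain ⟨c, hc⟩ := hK.deriv_bounded
  have hc0 : 0 ≤ c := (abs_nonneg _).trans (hc 0)
  refine ⟨2 * c, by positivity, fun x t hx => ?_⟩
  have h := convex_univ.norm_image_sub_le_of_norm_deriv_le (f := K) (C := c)
    (fun y _ => (hK.contDiff.differentiable one_ne_zero).differentiableAt) (fun y _ => hc y)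
    (mem_univ (t + x)) (mem_univ (t - x))
  have e : t - x - (t + x) = -(2 * x) := by ring
  rw [e, norm_neg, Real.norm_of_nonneg (by positivity : 0 ≤ 2 * x), Real.norm_eq_abs] at h
  rw [diffKernel, ← hK.even (x - t), neg_sub, add_comm x t]
  linarith [le_abs_self (K (t - x) - K (t + x))]

lemma two_mul_le_kernelTail_sub (hK : KernelConditions K) {x : ℝ} (hx0 : 0 ≤ x) (hx1 : x ≤ 1) :
    2 * x * K 2 ≤ kernelTail K (1 - x) - kernelTail K (1 + x) := by
  have h1 : ∫ _ in (1 - x)..(1 + x), K 2 ≤ ∫ t in (1 - x)..(1 + x), K t := by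
    apply intervalIntegral.integral_mono_on (by linarith) (by simp)
      (hK.continuous.intervalIntegrable _ _)
    intro t ht
    apply hK.le_of_abs_le
    rw [abs_of_nonneg (by linarith [ht.1]), abs_of_nonneg (by norm_num)]
    linarith [ht.2]
  have h2 := hK.kernelTail_eq_add (1 - x) (1 + x)
  simp only [intervalIntegral.integral_const, smul_eq_mul] at h1
  linarith

/-- The image of an integrable function is dominated by the image of a nondecreasing profile: near
the origin the former is `O(x)` since `K'` is bounded, the latter is at least of order `x`, and
away from the origin the former is bounded and the latter bounded below. -/
lemma exists_kernelOp_le_mul (hK : KernelConditions K) (hF : IsProfile F)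
    (hmono : MonotoneOn F (Ici 0)) (hF1 : 0 < F 1) (hg : IntegrableOn g (Ioi 0))
    (hg0 : ∀ t, 0 < t → 0 ≤ g t) :
    ∃ C, 0 < C ∧ ∀ x, 0 ≤ x → kernelOp K g x ≤ C * kernelOp K F x := by
  obtain ⟨D, hD0, hD⟩ := hK.exists_diffKernel_le
  set I := ∫ t in Ioi 0, g t
  have hI : 0 ≤ I := setIntegral_nonneg measurableSet_Ioi hg0
  have hFmono := hK.monotone_kernelOp hF.admissible (fun t ht => hF.nonneg t ht.le)
    (hmono.mono Ioi_subset_Ici_self)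
  have hlow : ∀ x, 0 ≤ x → x ≤ 1 → 2 * x * K 2 * F 1 ≤ kernelOp K F x := by
    intro x hx0 hx1
    have hint : IntegrableOn (fun t => diffKernel K x t * F t) (Ioi 0) :=
      hK.integrableOn_mul hF.admissible x
    have h01 : Ioi (1 : ℝ) ⊆ Ioi 0 := Ioi_subset_Ioi zero_le_one
    calc _ ≤ (∫ t in Ioi 1, diffKernel K x t) * F 1 := by
          rw [hK.integral_diffKernel]
          exact mul_le_mul_of_nonneg_right (hK.two_mul_le_kernelTail_sub hx0 hx1) hF1.le
      _ = ∫ t in Ioi 1, diffKernel K x t * F 1 := (integral_mul_const _ _).symm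
      _ ≤ ∫ t in Ioi 1, diffKernel K x t * F t := by
          refine setIntegral_mono_on ((hK.integrable_diffKernel x).integrableOn.mul_const _)
            (hint.mono_set h01) measurableSet_Ioi fun t ht => ?_
          have ht1 : 1 < t := ht
          exact mul_le_mul_of_nonneg_left
            (hmono (mem_Ici.2 zero_le_one) (mem_Ici.2 (by linarith)) ht1.le)
            (hK.diffKernel_nonneg hx0 (by linarith))
      _ ≤ _ := setIntegral_mono_set hint (ae_Ioi_of_forall fun t ht =>
          mul_nonneg (hK.diffKernel_nonneg hx0 ht.le) (hF.nonneg t ht.le)) h01.eventuallyLE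
  have hK2 := hK.pos 2
  have hK0 := hK.pos 0
  have hT1 : 0 < kernelOp K F 1 :=
    lt_of_lt_of_le (by positivity) (hlow 1 zero_le_one le_rfl)
  have hC1 : 0 ≤ D * I / (2 * K 2 * F 1) := by positivity
  have hC2 : 0 ≤ K 0 * I / kernelOp K F 1 := by positivity
  refine ⟨D * I / (2 * K 2 * F 1) + K 0 * I / kernelOp K F 1 + 1, by positivity, fun x hx => ?_⟩
  have hT0 : 0 ≤ kernelOp K F x := hK.kernelOp_nonneg (fun t ht => hF.nonneg t ht.le) hx
  rcases le_total x 1 with h1 | h1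
  · have h2 : kernelOp K g x ≤ D * x * I := by
      simp only [kernelOp, I, ← integral_const_mul]
      exact setIntegral_mono_on (hK.integrableOn_mul (.of_integrableOn hg) x) (hg.const_mul _)
        measurableSet_Ioi fun t ht => mul_le_mul_of_nonneg_right (hD x t hx) (hg0 t ht)
    have h3 : D * x * I ≤ D * I / (2 * K 2 * F 1) * kernelOp K F x := by
      calc D * x * I = D * I / (2 * K 2 * F 1) * (2 * x * K 2 * F 1) := by field_simp
        _ ≤ _ := mul_le_mul_of_nonneg_left (hlow x hx h1) hC1
    nlinarith [mul_nonneg hC2 hT0]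
  · have h2 := hK.kernelOp_le_integral hg hg0 x
    have h3 : K 0 * I ≤ K 0 * I / kernelOp K F 1 * kernelOp K F x := by
      calc K 0 * I = K 0 * I / kernelOp K F 1 * kernelOp K F 1 := by field_simp
        _ ≤ _ := mul_le_mul_of_nonneg_left (hFmono h1) hC2
    nlinarith [mul_nonneg hC1 hT0]

end KernelConditions

/-! ### Geometric convergence -/

section Geometric

variable {K Q φ μ U : ℝ → ℝ} {ω : ℝ → ℝ → ℝ} {M ξ σ : ℝ}

lemma QConditions.phi_iterate_mem (hQ : QConditions Q M ξ φ) (hM : 0 ≤ M) (h0 : 0 < σ)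
    (h1 : σ < 1) (n : ℕ) : σ ≤ φ^[n] σ ∧ φ^[n] σ < 1 := by
  induction n with
  | zero => exact ⟨le_rfl, h1⟩
  | succ n ih =>
    rw [Function.iterate_succ_apply']
    have hpos : 0 < φ^[n] σ := h0.trans_le ih.1
    exact ⟨ih.1.trans (hQ.lt_phi hpos ih.2).le, hQ.phi_lt_one hM hpos ih.2⟩

lemma QConditions.one_sub_phi_iterate_le (hQ : QConditions Q M ξ φ) (hM : 0 ≤ M) (h0 : 0 < σ)
    (h1 : σ < 1) {ε : ℝ} (hε0 : 0 < ε) (hε1 : ε < 1) (hk : 0 ≤ geometricRatio φ σ ε) (n : ℕ) :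
    1 - φ^[n] σ ≤ geometricRatio φ σ ε ^ n * (1 - σ) := by
  induction n with
  | zero => simp
  | succ n ih =>
    obtain ⟨h2, h3⟩ := hQ.phi_iterate_mem hM h0 h1 n
    have hεσ : ε * σ ≤ σ := mul_le_of_le_one_left h0.le hε1.le
    have h4 := hQ.one_sub_le_phi (r := ε * σ) (s := φ^[n] σ) (by positivity)
      (hεσ.trans_lt h1) (hεσ.trans h2) h3.le
    rw [Function.iterate_succ_apply', pow_succ', mul_assoc]
    have h5 := mul_le_mul_of_nonneg_left ih hk
    simp only [geometricRatio] at h5 ⊢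
    linarith

/-- A bound `σ Q(B₀) ≤ Q(B₁)` propagates to `φⁿ(σ) Q(Bₙ) ≤ Q(Bₙ₊₁)`: passing to the inverse of `Q`
replaces the factor by its image under `φ`, and the concavity of `ω` carries the new factor
through the operator. -/
lemma phi_iterate_mul_le (hK : KernelConditions K) (hQ : QConditions Q M ξ φ) (hM : 0 ≤ M)
    (hω : OmegaConditions ω μ) (hU : IsProfile U) (hU0 : U 0 = 0)
    (hUξ : ∀ x, 0 < x → U x < ξ) (h0 : 0 < σ) (h1 : σ < 1)
    (hsuper : ∀ x, 0 ≤ x → approxStep K Q (mainNonlinearity ω) U x ≤ U x)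
    (hpos : ∀ n x, 0 < x → 0 < (approxStep K Q (mainNonlinearity ω))^[n] U x)
    (hσ : ∀ x, 0 ≤ x → σ * Q (U x) ≤ Q (approxStep K Q (mainNonlinearity ω) U x)) (n : ℕ) :
    ∀ x, 0 ≤ x → φ^[n + 1] σ * (approxStep K Q (mainNonlinearity ω))^[n] U x
      ≤ (approxStep K Q (mainNonlinearity ω))^[n + 1] U x := by
  have hN := hω.sandwiched
  set A : ℕ → ℝ → ℝ := fun n => (approxStep K Q (mainNonlinearity ω))^[n] U
  have hA : ∀ n, IsProfile (A n) := hU.iterate hK hQ hM hN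
  have hanti : ∀ n x, 0 ≤ x → A (n + 1) x ≤ A n x := iterate_succ_le hK hQ hM hN hU hsuper
  have hAU : ∀ n x, 0 ≤ x → A n x ≤ U x := by
    intro n x hx
    exact antitone_nat_of_succ_le (f := fun n => A n x) (fun n => hanti n x hx) (Nat.zero_le n)
  -- The bound for `Q(Bₙ)` gives the bound for `Bₙ` with the next factor.
  have hinv : ∀ n, (∀ x, 0 ≤ x → φ^[n] σ * Q (A n x) ≤ Q (A (n + 1) x)) →
      ∀ x, 0 ≤ x → φ^[n + 1] σ * A n x ≤ A (n + 1) x := by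
    intro n hn x hx
    obtain ⟨h2, h3⟩ := hQ.phi_iterate_mem hM h0 h1 n
    have hs : 0 < φ^[n] σ := h0.trans_le h2
    rcases hx.eq_or_lt with rfl | hx
    · have : A n 0 = 0 := le_antisymm ((hAU n 0 le_rfl).trans_eq hU0) ((hA n).nonneg 0 le_rfl)
      rw [this, mul_zero]
      exact (hA (n + 1)).nonneg 0 le_rfl
    · have hAn := hpos n x hx
      have hQpos : 0 < Q (A n x) := by
        rw [← hQ.zero]; exact hQ.strictMono self_mem_Ici hAn.le hAn
      have hQlt : Q (A n x) < (1 + M) * ξ := by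
        rw [← hQ.xi_eq]
        exact hQ.strictMono hAn.le hQ.xi_pos.le ((hAU n x hx.le).trans_lt (hUξ x hx))
      have h4 := hQ.inverse_ge _ ⟨hs, h3⟩ _ ⟨hQpos, hQlt⟩
      rw [hQ.inverse_apply hM hAn.le] at h4
      rw [Function.iterate_succ_apply']
      refine h4.trans ?_
      rw [hQ.inverse_le_iff hM ((hA (n + 1)).nonneg x hx.le) (by positivity)]
      exact hn x hx.le
  have hQiter : ∀ n x, 0 ≤ x → φ^[n] σ * Q (A n x) ≤ Q (A (n + 1) x) := by
    intro n
    induction n with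
    | zero => exact hσ
    | succ n ih =>
      intro x hx
      obtain ⟨h2, h3⟩ := hQ.phi_iterate_mem hM h0 h1 (n + 1)
      have hs : 0 ≤ φ^[n + 1] σ := h0.le.trans h2
      have e : ∀ m, Q (A (m + 1) x) = kernelOp K (fun t => mainNonlinearity ω t (A m t)) x := by
        intro m
        simp only [A, Function.iterate_succ_apply']
        exact apply_approxStep hK hQ hM hN (hA m).nonneg hx
      rw [e, e, ← kernelOp_const_mul]
      refine hK.kernelOp_mono ((hN.admissible (hA n)).const_mul _) (hN.admissible (hA (n + 1)))
        (fun t ht => ?_) hx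
      have hAt := (hA n).nonneg t ht.le
      exact (hω.mul_le_main ht.le hAt hs h3.le).trans
        (hN.mono t ht (mul_nonneg hs hAt) ((hA (n + 1)).nonneg t ht.le) (hinv n ih t ht.le))
  exact hinv n (hQiter n)

lemma le_of_tendsto_of_geometric {a : ℕ → ℝ} {l c k : ℝ} (hk0 : 0 ≤ k) (hk1 : k < 1)
    (ha : Tendsto a atTop (𝓝 l)) (hstep : ∀ n, a n - a (n + 1) ≤ c * k ^ (n + 1)) (n : ℕ) :
    a n - l ≤ c / (1 - k) * k ^ (n + 1) := by
  have hd : 0 < 1 - k := by linarith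
  have hmono : Monotone fun n => a n - c / (1 - k) * k ^ (n + 1) := by
    refine monotone_nat_of_le_succ fun n => ?_
    have h := hstep n
    have e : c / (1 - k) * k ^ (n + 1) - c / (1 - k) * k ^ (n + 1 + 1) = c * k ^ (n + 1) := by
      field_simp
      ring
    linarith
  have hlim : Tendsto (fun n => a n - c / (1 - k) * k ^ (n + 1)) atTop (𝓝 l) := by
    have := ha.sub (((tendsto_add_atTop_iff_nat 1).2
      (tendsto_pow_atTop_nhds_zero_of_lt_one hk0 hk1)).const_mul (c / (1 - k)))
    simpa using this
  have := hmono.ge_of_tendsto hlim n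
  linarith

end Geometric

/-! ### The three equations -/

/-- The lower equation has exactly one nontrivial solution, and it is nondecreasing because the
approximations from a constant are. -/
lemma exists_lower_solution {K Q φ : ℝ → ℝ} {M ξ η : ℝ} (hK : KernelConditions K)
    (hQ : QConditions Q M ξ φ) (hM : 0 ≤ M) (hη0 : 0 < η) (hη : Q η = η) :
    ∃ F, IsNontrivialSolution K Q lowerNonlinearity F ∧ MonotoneOn F (Ici 0) ∧
      (∀ F', IsNontrivialSolution K Q lowerNonlinearity F' → EqOn F' F (Ici 0)) ∧
      ∀ x, 0 ≤ x → F x ≤ η := by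
  have hη' : Q η = (1 + K 0 * ∫ _ in Ioi (0 : ℝ), (0 : ℝ)) * η := by simp [hη]
  obtain ⟨F, hF, hmax, hlim⟩ := exists_largest_solution hK hQ hM sandwiched_lower hη0 hη'
  refine ⟨F, hF, ?_, fun F' hF' => ?_, hF.le_of_eq_mul hK hQ hM sandwiched_lower hη0 hη'⟩
  · have hprof := (IsProfile.const hη0.le).iterate hK hQ hM sandwiched_lower
    have hmono : ∀ n, MonotoneOn ((approxStep K Q lowerNonlinearity)^[n] fun _ => η) (Ici 0) := by
      intro n
      induction n with
      | zero => exact fun _ _ _ _ _ => le_rfl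
      | succ n ih =>
        rw [Function.iterate_succ_apply']
        intro x hx y _ hxy
        refine hQ.inverse_mono hM
          (kernelOp_sandwiched_nonneg hK sandwiched_lower (hprof n).nonneg hx) ?_
        exact hK.monotone_kernelOp (hprof n).admissible (fun t ht => (hprof n).nonneg t ht.le)
          (ih.mono Ioi_subset_Ici_self) hxy
    exact fun x hx y hy hxy => le_of_tendsto_of_tendsto' (hlim x hx) (hlim y hy)
      fun n => hmono n hx hy hxy
  · have hle := hmax F' hF'
    rw [lowerNonlinearity_eq] at hF hF'
    exact hF'.eqOn_of_le hF hK hQ hM (fun _ _ => le_rfl) integrableOn_zero hle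

theorem theorem2 (K Q φ μ : ℝ → ℝ) (ω : ℝ → ℝ → ℝ) (ξ : ℝ)
    (hK : KernelConditions K)
    (hω : OmegaConditions ω μ)
    (hQ : QConditions Q (massConstant K μ) ξ φ) :
    -- the positive fixed point of `Q`
    ∃ η : ℝ, 0 < η ∧ Q η = η ∧ (∀ v, 0 < v → Q v = v → v = η) ∧
    -- the unique nondecreasing solution of the lower auxiliary equation
    ∃ F : ℝ → ℝ,
      IsNontrivialSolution K Q lowerNonlinearity F ∧ MonotoneOn F (Ici 0) ∧
      (∀ F' : ℝ → ℝ, IsNontrivialSolution K Q lowerNonlinearity F' → MonotoneOn F' (Ici 0) →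
        EqOn F' F (Ici 0)) ∧
      F 0 = 0 ∧ (∀ x, 0 < x → 0 < F x) ∧ Tendsto F atTop (𝓝 η) ∧
      IntegrableOn (fun x => η - F x) (Ioi 0) ∧
    -- the unique solution of the upper auxiliary equation
    ∃ Φ : ℝ → ℝ,
      IsNontrivialSolution K Q (upperNonlinearity μ) Φ ∧
      (∀ Φ' : ℝ → ℝ, IsNontrivialSolution K Q (upperNonlinearity μ) Φ' →
        EqOn Φ' Φ (Ici 0)) ∧
      Φ 0 = 0 ∧ (∀ x, 0 < x → F x < Φ x ∧ Φ x < ξ) ∧ Tendsto Φ atTop (𝓝 η) ∧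
      IntegrableOn (fun x => η - Φ x) (Ioi 0) ∧
    -- the solution of the main equation
    ∃ B : ℝ → ℝ,
      IsNontrivialSolution K Q (mainNonlinearity ω) B ∧
      (∀ x, 0 ≤ x → F x ≤ B x ∧ B x ≤ Φ x) ∧ Tendsto B atTop (𝓝 η) ∧
      IntegrableOn (fun x => η - B x) (Ioi 0) ∧
    -- the successive approximations starting from `Φ`
    ∃ Bn : ℕ → ℝ → ℝ,
      EqOn (Bn 0) Φ (Ici 0) ∧
      (∀ n, IsStep K Q (mainNonlinearity ω) (Bn n) (Bn (n + 1))) ∧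
      (∀ n, ContinuousOn (Bn n) (Ici 0)) ∧
      (∀ n x, 0 ≤ x → 0 ≤ Bn n x ∧ Bn (n + 1) x ≤ Bn n x ∧ F x ≤ Bn n x) ∧
    -- uniform geometric convergence, with `σ₀` bounding `Q(B₁) / Q(B₀)` from below
    ∃ σ₀ : ℝ, 0 < σ₀ ∧ σ₀ < 1 ∧
      (∀ x, 0 ≤ x → σ₀ * Q (Bn 0 x) ≤ Q (Bn 1 x)) ∧
      ∀ ε₀ : ℝ, 0 < ε₀ → ε₀ < 1 →
        0 < geometricRatio φ σ₀ ε₀ ∧ geometricRatio φ σ₀ ε₀ < 1 ∧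
        ∀ n x, 0 ≤ x →
          0 ≤ Bn n x - B x ∧
          Bn n x - B x ≤
            ξ * (1 - σ₀) / (1 - geometricRatio φ σ₀ ε₀) * geometricRatio φ σ₀ ε₀ ^ (n + 1) := by
  have hμ0 : ∀ t, 0 < t → 0 ≤ μ t := fun t ht => (hω.majorant_pos t ht.le).le
  have hμ := hω.majorant_integrable
  have hMeq : massConstant K μ = K 0 * ∫ t in Ioi 0, μ t := by
    rw [massConstant, hK.iSup_eq, mul_comm]
  have hM : 0 ≤ massConstant K μ := by
    rw [hMeq]; exact mul_nonneg (hK.pos 0).le (setIntegral_nonneg measurableSet_Ioi hμ0)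
  have hξ : Q ξ = (1 + K 0 * ∫ t in Ioi 0, μ t) * ξ := by rw [hQ.xi_eq, hMeq]
  have hξ0 := hQ.xi_pos
  have hNu := sandwiched_upper hμ0 hμ
  have hNm := hω.sandwiched
  obtain ⟨η, hη0, hηξ, hη⟩ := hQ.exists_fixedPoint hM
  obtain ⟨F, hF, hFmono, hFuniq, hFη⟩ := exists_lower_solution hK hQ hM hη0 hη
  have hFpos : ∀ x, 0 < x → 0 < F x := fun x hx => hF.pos hK hQ sandwiched_lower hx
  have hFeq : ∀ x, 0 ≤ x → Q (F x) = kernelOp K F x := fun x hx => hF.eqn.eq_kernelOp hx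
  obtain ⟨Φ, hΦ, hΦmax, hΦlim⟩ := exists_largest_solution hK hQ hM hNu hξ0 hξ
  have hΦξ := hΦ.le_of_eq_mul hK hQ hM hNu hξ0 hξ
  have hFΦ : ∀ x, 0 ≤ x → F x ≤ Φ x := fun x hx => ge_of_tendsto' (hΦlim x hx) fun n =>
    le_iterate hK hQ hM hNu (.const hξ0.le) hF.isProfile (fun y hy => by
      rw [hFeq y hy]; exact hK.kernelOp_le_kernelOp_sandwiched hNu hF.isProfile hy)
      (fun y hy => (hFη y hy).trans hηξ) n x hx
  -- The operator applied to the excess `μ Φ` separates `Φ` from `F`.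
  have hμΦ : IntegrableOn (fun t => μ t * Φ t) (Ioi 0) := by
    refine Integrable.mono' (g := fun t => ξ * μ t) (hμ.const_mul ξ)
      (hμ.1.mul hΦ.isProfile.admissible.meas) (ae_Ioi_of_forall fun t ht => ?_)
    rw [Real.norm_of_nonneg (mul_nonneg (hμ0 t ht) (hΦ.nonneg t ht.le)), mul_comm ξ]
    exact mul_le_mul_of_nonneg_left (hΦξ t ht.le) (hμ0 t ht)
  have hμΦ0 : ∀ t, 0 < t → 0 ≤ μ t * Φ t := fun t ht => mul_nonneg (hμ0 t ht) (hΦ.nonneg t ht.le)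
  have hΦeq : ∀ x, 0 ≤ x → Q (Φ x) = kernelOp K Φ x + kernelOp K (fun t => μ t * Φ t) x := by
    intro x hx
    rw [hΦ.eqn.eq_kernelOp hx, ← hK.kernelOp_add hΦ.isProfile.admissible (.of_integrableOn hμΦ)]
    simp only [upperNonlinearity, add_mul, one_mul]
  have hTFΦ : ∀ x, 0 ≤ x → kernelOp K F x ≤ kernelOp K Φ x := fun x hx =>
    hK.kernelOp_mono hF.isProfile.admissible hΦ.isProfile.admissible
      (fun t ht => hFΦ t ht.le) hx
  have hFΦlt : ∀ x, 0 < x → F x < Φ x := by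
    intro x hx
    rw [← hQ.strictMono.lt_iff_lt (hF.nonneg x hx.le) (hΦ.nonneg x hx.le), hFeq x hx.le,
      hΦeq x hx.le]
    have hpos : 0 < kernelOp K (fun t => μ t * Φ t) x := by
      refine lt_of_le_of_ne (hK.kernelOp_nonneg hμΦ0 hx.le) fun h0 => ?_
      have hae := hK.ae_eq_zero_of_kernelOp_eq_zero (.of_integrableOn hμΦ) hμΦ0 hx h0.symm
      have hne : (ae (volume.restrict (Ioi (0 : ℝ)))).NeBot := by
        rw [ae_neBot]; simp
      obtain ⟨t, ht, ht0⟩ := (hae.and (ae_restrict_mem measurableSet_Ioi)).exists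
      exact (mul_pos (hω.majorant_pos t (le_of_lt ht0)) (hΦ.pos hK hQ hNu ht0)).ne' ht
    linarith [hTFΦ x hx.le]
  have hΦξlt : ∀ x, 0 < x → Φ x < ξ := by
    intro x hx
    rw [← hQ.strictMono.lt_iff_lt (hΦ.nonneg x hx.le) hξ0.le, hΦ.eqn.eq_kernelOp hx.le, hξ]
    have h1 := hK.kernelOp_sandwiched_le_mul hNu hΦ.isProfile hΦξ hx.le
    have h2 := mul_pos hξ0 (hK.kernelTail_pos x)
    linarith
  have hsuper : ∀ x, 0 ≤ x → approxStep K Q (mainNonlinearity ω) Φ x ≤ Φ x := by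
    intro x hx
    refine approxStep_le hK hQ hM hNm hΦ.isProfile hx (hΦ.nonneg x hx) ?_
    rw [hΦ.eqn.eq_kernelOp hx]
    exact hK.kernelOp_mono (hNm.admissible hΦ.isProfile) (hNu.admissible hΦ.isProfile)
      (fun t ht => hNm.le_mul t ht _ (hΦ.nonneg t ht.le)) hx
  obtain ⟨B, hBprof, hBstep, hBlim⟩ := exists_tendsto_iterate hK hQ hM hNm hΦ.isProfile hsuper
  set A : ℕ → ℝ → ℝ := fun n => (approxStep K Q (mainNonlinearity ω))^[n] Φ
  have hA : ∀ n, IsProfile (A n) := hΦ.isProfile.iterate hK hQ hM hNm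
  have hFA : ∀ n x, 0 ≤ x → F x ≤ A n x := le_iterate hK hQ hM hNm hΦ.isProfile hF.isProfile
    (fun y hy => by
      rw [hFeq y hy]; exact hK.kernelOp_le_kernelOp_sandwiched hNm hF.isProfile hy) hFΦ
  have hAsucc : ∀ n x, 0 ≤ x → A (n + 1) x ≤ A n x :=
    iterate_succ_le hK hQ hM hNm hΦ.isProfile hsuper
  have hAanti : ∀ x, 0 ≤ x → Antitone fun n => A n x := fun x hx =>
    antitone_nat_of_succ_le fun n => hAsucc n x hx
  have hFB : ∀ x, 0 ≤ x → F x ≤ B x := fun x hx => ge_of_tendsto' (hBlim x hx) fun n => hFA n x hx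
  have hBA : ∀ n x, 0 ≤ x → B x ≤ A n x := fun n x hx => (hAanti x hx).le_of_tendsto (hBlim x hx) n
  have hB : IsNontrivialSolution K Q (mainNonlinearity ω) B :=
    ⟨hBprof.nonneg, ⟨1, zero_le_one, ((hFpos 1 one_pos).trans_le (hFB 1 zero_le_one)).ne'⟩,
      hBprof.bounded, hBprof.cont, hBstep⟩
  have hstep : ∀ n, IsStep K Q (mainNonlinearity ω) (A n) (A (n + 1)) := by
    intro n
    simp only [A, Function.iterate_succ_apply']
    exact isStep_approxStep hK hQ hM hNm (hA n)
  obtain ⟨C, hC0, hC⟩ := hK.exists_kernelOp_le_mul hF.isProfile hFmono (hFpos 1 one_pos) hμΦ hμΦ0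
  have hσ1 : 1 / (1 + C) < 1 := by rw [div_lt_one (by linarith)]; linarith
  have hσ0 : 0 < 1 / (1 + C) := by positivity
  have hσ : ∀ x, 0 ≤ x → 1 / (1 + C) * Q (A 0 x) ≤ Q (A 1 x) := by
    intro x hx
    have h1 : kernelOp K Φ x ≤ Q (A 1 x) := by
      rw [(hstep 0).eq_kernelOp hx]
      exact hK.kernelOp_le_kernelOp_sandwiched hNm hΦ.isProfile hx
    have h2 : Q (A 0 x) = _ := hΦeq x hx
    have h3 := mul_le_mul_of_nonneg_left (hTFΦ x hx) hC0.le
    rw [div_mul_eq_mul_div, one_mul, div_le_iff₀ (by linarith), h2]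
    nlinarith [hC x hx]
  refine ⟨η, hη0, hη, fun v hv hQv => ?_, F, hF, hFmono, fun F' hF' _ => hFuniq F' hF',
    hF.apply_zero hK hQ, hFpos, hF.tendsto hK hQ hM sandwiched_lower hη0 hη,
    hF.integrableOn_sub hK hQ hM sandwiched_lower hη0 hη,
    Φ, hΦ, fun Φ' hΦ' => hΦ'.eqOn_of_le hΦ hK hQ hM hμ0 hμ (hΦmax Φ' hΦ'), hΦ.apply_zero hK hQ,
    fun x hx => ⟨hFΦlt x hx, hΦξlt x hx⟩, hΦ.tendsto hK hQ hM hNu hη0 hη,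
    hΦ.integrableOn_sub hK hQ hM hNu hη0 hη,
    B, hB, fun x hx => ⟨hFB x hx, hBA 0 x hx⟩, hB.tendsto hK hQ hM hNm hη0 hη,
    hB.integrableOn_sub hK hQ hM hNm hη0 hη,
    A, fun _ _ => rfl, hstep, fun n => (hA n).cont,
    fun n x hx => ⟨(hA n).nonneg x hx, hAsucc n x hx, hFA n x hx⟩,
    1 / (1 + C), hσ0, hσ1, hσ, fun ε hε0 hε1 => ?_⟩
  · rcases lt_trichotomy v η with h | h | h
    · exact absurd hQv (hQ.lt_self_of_lt hM hη hv h).ne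
    · exact h
    · exact absurd hQv (hQ.self_lt_of_lt hM hη0 hη h).ne'
  set σ := 1 / (1 + C)
  have hr0 : 0 < ε * σ := mul_pos hε0 hσ0
  have hr1 : ε * σ < 1 := by nlinarith
  have hd : 0 < 1 - ε * σ := by linarith
  have hk0 : 0 < geometricRatio φ σ ε := div_pos (by linarith [hQ.phi_lt_one hM hr0 hr1]) hd
  have hk1 : geometricRatio φ σ ε < 1 := by
    rw [geometricRatio, div_lt_one hd]; linarith [hQ.lt_phi hr0 hr1]
  refine ⟨hk0, hk1, fun n x hx => ⟨sub_nonneg.2 (hBA n x hx), ?_⟩⟩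
  refine le_of_tendsto_of_geometric hk0.le hk1 (hBlim x hx) (fun n => ?_) n
  have h1 := phi_iterate_mul_le hK hQ hM hω hΦ.isProfile (hΦ.apply_zero hK hQ) hΦξlt hσ0 hσ1 hsuper
    (fun n x hx => (hFpos x hx).trans_le (hFA n x hx.le)) hσ n x hx
  have h2 := hQ.one_sub_phi_iterate_le hM hσ0 hσ1 hε0 hε1 hk0.le (n + 1)
  have h3 : A n x ≤ ξ := (hAanti x hx (Nat.zero_le n)).trans (hΦξ x hx)
  have h4 := (hA n).nonneg x hx
  have h5 : (1 - φ^[n + 1] σ) * A n x ≤ geometricRatio φ σ ε ^ (n + 1) * (1 - σ) * ξ :=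
    mul_le_mul h2 h3 h4 (mul_nonneg (pow_nonneg hk0.le _) (by linarith))
  simp only [A] at h5 ⊢
  linarith
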